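/- Let $\rho\in\mathbb C$ with $0<|\rho|<1$, let $\sigma>0$, $\eta=1/\sigma^2$, and let $\beta>1$. For numbers of antennas $N_t$ and $N_r=\beta N_t$ consider the channel model $\mathbf r=\mathbf H\mathbf F\mathbf s+\boldsymbol\xi$ with the uniform precoder $\mathbf F=\frac1{\sqrt{N_t}}\mathbf I$, where - $\mathbf H\in\mathbb C^{N_r\times N_t}$ is zero-mean circularly-symmetric complex Gaussian with covariance $\mathbf I\otimes\boldsymbol\Sigma$, i.e. $\mathbb E[\overline{h_{\ell m}}\,h_{kn}]=\delta_{\ell k}[\boldsymbol\Sigma]_{mn}$, and $\boldsymbol\Sigma$ is the $N_t\times N_t$ Kac–Murdock–Szegő matrix, $[\boldsymbol\Sigma]_{mn}=\rho^{\,n-m}$ for $m\le n$ and $[\boldsymbol\Sigma]_{mn}=\overline{[\boldsymbol\Sigma]_{nm}}$ for $m>n$; - $\boldsymbol\xi\in\mathbb C^{N_r}$ is zero-mean circularly-symmetric complex Gaussian noise with covariance $\sigma^2\mathbf I$; - the entries $s_1,\dots,s_{N_t}$ of $\mathbf s$ are independent and uniformly distributed on a constellation $\mathcal S\subset\mathbb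 C$ of $M\ge 2$ points with zero mean and unit average energy, and $\mathbf H,\mathbf s,\boldsymbol\xi$ are independent; - the zero-forcing detector forms $\mathbf r'=\big((\mathbf H\mathbf F)^H\mathbf H\mathbf F\big)^{-1}(\mathbf H\mathbf F)^H\mathbf r$ and decides $\hat s_k\in\arg\min_{a\in\mathcal S}|r'_k-a|$ (ties broken arbitrarily). The average symbol error probability is $\mathrm P=\frac1{N_t}\sum_{k=1}^{N_t}\Pr(\hat s_k\ne s_k)$, the probability being taken over $\mathbf H$, $\mathbf s$ and $\boldsymbol\xi$. Write $Q(x)=\frac1{\sqrt{2\pi}}\int_x^\infty e^{-t^2/2}\,dt$. Then, as $N_t\to\infty$ with $N_r/N_t=\beta$ fixed, $\mathrm P$ converges, and its limit is 1. for $M$-ary PAM, $\mathcal S=\big\{\sqrt{\tfrac{3}{M^2-1}}\,(2m+1-M):0\le m<M\big\}$: $$\frac{2(M-1)}{M}\,Q\!\left(\sqrt{\frac{6\eta(\beta-1)(1-|\rho|^2)}{(M^2-1)(1+|\rho|^2)}}\right);$$ 2. for $M$-ary PSK, $\mathcal S=\{e^{2\pi \mathrm i m/M}:0\le m<M\}$: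 $$\frac1\pi\int_0^{(M-1)\pi/M}\exp\!\left(-\frac{\eta(\beta-1)(1-|\rho|^2)\sin^2(\pi/M)}{(1+|\rho|^2)\sin^2\theta}\right)d\theta;$$ 3. for square $M$-ary QAM, $M=L^2$ with an integer $L\ge2$, $\mathcal S=\big\{\sqrt{\tfrac{3}{2(M-1)}}\,\big((2a+1-L)+\mathrm i(2b+1-L)\big):0\le a,b<L\big\}$: $$\frac{4(\sqrt M-1)}{\sqrt M}\,Q\!\left(\sqrt{\frac{3\eta(\beta-1)(1-|\rho|^2)}{(M-1)(1+|\rho|^2)}}\right)-\frac{4(\sqrt M-1)^2}{M}\,Q^2\!\left(\sqrt{\frac{3\eta(\beta-1)(1-|\rho|^2)}{(M-1)(1+|\rho|^2)}}\right).$$ -/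

import Mathlib

open MeasureTheory ProbabilityTheory Filter Topology
open scoped ComplexConjugate

noncomputable section

/-- The Gaussian tail function `Q(x) = (1/√(2π)) ∫_x^∞ e^{-t²/2} dt`. -/
def gaussQ (x : ℝ) : ℝ :=
  (1 / Real.sqrt (2 * Real.pi)) * ∫ t in Set.Ioi x, Real.exp (-t ^ 2 / 2)

/-- The `M`-ary PAM constellation: `M` equally spaced real points, symmetric about the origin,
scaled to unit average energy. -/
def pamConstellation (M : ℕ) : Set ℂ :=
  Set.range fun m : Fin M =>
    ((Real.sqrt (3 / ((M : ℝ) ^ 2 - 1)) * (2 * (m : ℝ) + 1 - (M : ℝ)) : ℝ) : ℂ)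

/-- The `M`-ary PSK constellation: the `M`-th roots of unity. -/
def pskConstellation (M : ℕ) : Set ℂ :=
  Set.range fun m : Fin M => Complex.exp (2 * (Real.pi : ℂ) * Complex.I * (m : ℂ) / (M : ℂ))

/-- The square QAM constellation with `L²` points: an `L × L` grid of equally spaced points,
centred at the origin and scaled to unit average energy. -/
def squareQAMConstellation (L : ℕ) : Set ℂ :=
  Set.range fun p : Fin L × Fin L =>
    ((Real.sqrt (3 / (2 * ((L : ℝ) ^ 2 - 1))) : ℝ) : ℂ) *
      (((2 * (p.1 : ℝ) + 1 - (L : ℝ) : ℝ) : ℂ) +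
        ((2 * (p.2 : ℝ) + 1 - (L : ℝ) : ℝ) : ℂ) * Complex.I)

/-- `X` is a zero-mean circularly-symmetric complex Gaussian vector whose covariance matrix
has the entries `C i j = E[conj (X i) * X j]`. -/
structure IsCircularGaussian {Ω ι : Type*} [MeasurableSpace Ω] [Fintype ι]
    (X : Ω → ι → ℂ) (C : Matrix ι ι ℂ) (μ : Measure Ω) : Prop where
  gaussian : HasGaussianLaw X μ
  mean_zero : ∀ i, ∫ ω, X ω i ∂μ = 0
  covariance : ∀ i j, ∫ ω, conj (X ω i) * X ω j ∂μ = C i j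
  circular : ∀ i j, ∫ ω, X ω i * X ω j ∂μ = 0

/-- The (Hermitian) Kac-Murdock-Szegő matrix: the entry `(m, n)` is `ρ^(n-m)` for `m ≤ n` and
the conjugate of the entry `(n, m)` for `m > n`. -/
def kmsMatrix (n : ℕ) (ρ : ℂ) : Matrix (Fin n) (Fin n) ℂ :=
  Matrix.of fun i j =>
    if i ≤ j then ρ ^ ((j : ℕ) - (i : ℕ)) else conj (ρ ^ ((i : ℕ) - (j : ℕ)))

/-- The uniform precoder `I / √n`. -/
def uniformPrecoder (n : ℕ) : Matrix (Fin n) (Fin n) ℂ :=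
  ((1 / Real.sqrt (n : ℝ) : ℝ) : ℂ) • (1 : Matrix (Fin n) (Fin n) ℂ)

/-- The pseudo-inverse `(Aᴴ A)⁻¹ Aᴴ` of a matrix of full column rank. -/
def pseudoInverse {m n : ℕ} (A : Matrix (Fin m) (Fin n) ℂ) : Matrix (Fin n) (Fin m) ℂ :=
  (A.conjTranspose * A)⁻¹ * A.conjTranspose

/-- The precoded MIMO link `r = H F s + ξ` with zero-forcing detection:
* the channel `H` is circularly-symmetric complex Gaussian with covariance `I ⊗ C`
  (independent rows, each with transmit covariance `C`);
* the noise `ξ` is circularly-symmetric complex Gaussian with covariance `σ² I`;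
* the symbols are independent and uniform on the constellation `S`;
* channel, symbols and noise are mutually independent;
* `sHat ω k` is a point of `S` nearest to the `k`-th entry of the equalized signal `(H F)⁺ r`
  (ties may be broken in any way). -/
structure IsZFLink {Ω : Type*} [MeasurableSpace Ω] (μ : Measure Ω) {nt nr : ℕ}
    (S : Set ℂ) (C F : Matrix (Fin nt) (Fin nt) ℂ) (σ : ℝ)
    (H : Ω → Matrix (Fin nr) (Fin nt) ℂ) (s : Ω → Fin nt → ℂ) (ξ : Ω → Fin nr → ℂ)
    (sHat : Ω → Fin nt → ℂ) : Prop where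
  channel : IsCircularGaussian (fun ω (p : Fin nr × Fin nt) => H ω p.1 p.2)
    (Matrix.kronecker (1 : Matrix (Fin nr) (Fin nr) ℂ) C) μ
  noise : IsCircularGaussian ξ (((σ ^ 2 : ℝ) : ℂ) • (1 : Matrix (Fin nr) (Fin nr) ℂ)) μ
  symbols_measurable : Measurable s
  symbols_indep : iIndepFun (fun k ω => s ω k) μ
  symbols_uniform : ∀ k, ∀ a ∈ S, μ.real {ω | s ω k = a} = 1 / (S.ncard : ℝ)
  indep_channel : IndepFun (fun ω (p : Fin nr × Fin nt) => H ω p.1 p.2)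
    (fun ω => (s ω, ξ ω)) μ
  indep_symbols_noise : IndepFun s ξ μ
  detector_mem : ∀ ω k, sHat ω k ∈ S
  detector_nearest : ∀ ω k, ∀ a ∈ S,
    ‖(pseudoInverse (H ω * F)).mulVec ((H ω * F).mulVec (s ω) + ξ ω) k - sHat ω k‖ ≤
      ‖(pseudoInverse (H ω * F)).mulVec ((H ω * F).mulVec (s ω) + ξ ω) k - a‖

/-- The average symbol error probability: the arithmetic mean over the `nt` symbols of the
probability (over channel, symbols and noise) of a wrong decision. -/
def averageSEP {Ω : Type*} [MeasurableSpace Ω] (μ : Measure Ω) {nt : ℕ}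
    (s sHat : Ω → Fin nt → ℂ) : ℝ :=
  (1 / (nt : ℝ)) * ∑ k, μ.real {ω | sHat ω k ≠ s ω k}

end

/-! Condition on the channel. When the Gram matrix `HᴴH` is invertible, zero forcing returns `s_k`
plus circular Gaussian noise of variance `v = σ² N_t [(HᴴH)⁻¹]_kk`, so the conditional error
probability is a function `f (1/v)` that depends only on the constellation. It remains to show that
`1/v` concentrates at a constant, and to compute `f`.

The reciprocal of `[(HᴴH)⁻¹]_kk` is the squared distance from the `k`-th column of `H` to the span
of the other columns (`gram_inv_diag`). The inverse of the Kac–Murdock–Szegő matrix is tridiagonal,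
so its normalized `k`-th column is an explicit vector `t` with `t k = 1` and `Σ t = τ e_k`, where `τ
= (1-|ρ|²)/(1+|ρ|²)` away from the two ends (`kms_interior`). Then `H t` differs from the `k`-th
column by an element of the span of the others, is independent of those others, and has independent
entries of variance `τ` (`innovation_law`). The distance is therefore the norm of a white Gaussian
vector projected onto an independent random subspace, almost surely of dimension `N_r - N_t + 1`.
Chebyshev's inequality puts its square near `(N_r - N_t + 1) τ` (`channel_gram_inv_concentration`),
so `1/v` is close to `x₀ = (β-1) τ / σ²`, with bounds uniform in the interior `k`.

Since `f` takes values in `[0,1]` and is continuous at `x₀`, every interior symbol has error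
probability close to `f x₀`; the two end symbols weigh at most `2/N_t` in the average
(`averageSEP_tendsto`).

For PAM and QAM, decision regions are products of intervals and `f` reduces to Gaussian tails
(`sum_grid_error`). For PSK they are rotated copies of one wedge, and polar coordinates give Craig's
integral (`cGauss_wedgeError`). -/

noncomputable section

open scoped NNReal ENNReal

/-- The law of a scalar circularly-symmetric complex Gaussian variable of variance `v`. -/
def cGauss (v : ℝ≥0) : Measure ℂ :=
  ((gaussianReal 0 (v / 2)).prod (gaussianReal 0 (v / 2))).map Complex.measurableEquivRealProd.symm

instance (v : ℝ≥0) : IsProbabilityMeasure (cGauss v) :=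
  Measure.isProbabilityMeasure_map Complex.measurableEquivRealProd.symm.measurable.aemeasurable

/-! ### Real second moments from complex ones -/

section moments

variable {Ω : Type*} [MeasurableSpace Ω] {μ : Measure Ω}

/-- The real and imaginary parts of the two complex moments are four linear equations in the four
real moments, and the system is invertible. -/
theorem integral_re_im_mul_of_circular {U V : Ω → ℂ} (hU : MemLp U 2 μ) (hV : MemLp V 2 μ)
    {c : ℂ} (h1 : ∫ ω, conj (U ω) * V ω ∂μ = c) (h2 : ∫ ω, U ω * V ω ∂μ = 0) :
    ∫ ω, (U ω).re * (V ω).re ∂μ = c.re / 2 ∧ ∫ ω, (U ω).im * (V ω).im ∂μ = c.re / 2 ∧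
    ∫ ω, (U ω).re * (V ω).im ∂μ = c.im / 2 ∧ ∫ ω, (U ω).im * (V ω).re ∂μ = -(c.im / 2) := by
  have i1 : Integrable (fun ω => (U ω).re * (V ω).re) μ := hU.re.integrable_mul hV.re
  have i2 : Integrable (fun ω => (U ω).im * (V ω).im) μ := hU.im.integrable_mul hV.im
  have i3 : Integrable (fun ω => (U ω).re * (V ω).im) μ := hU.re.integrable_mul hV.im
  have i4 : Integrable (fun ω => (U ω).im * (V ω).re) μ := hU.im.integrable_mul hV.re
  have j1 : Integrable (fun ω => conj (U ω) * V ω) μ := hU.star.integrable_mul hV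
  have j2 : Integrable (fun ω => U ω * V ω) μ := hU.integrable_mul hV
  have e1 := congrArg Complex.re h1
  have e2 := congrArg Complex.im h1
  have e3 := congrArg Complex.re h2
  have e4 := congrArg Complex.im h2
  have r1 : (∫ ω, conj (U ω) * V ω ∂μ).re = ∫ ω, (conj (U ω) * V ω).re ∂μ :=
    (integral_re j1).symm
  have r2 : (∫ ω, conj (U ω) * V ω ∂μ).im = ∫ ω, (conj (U ω) * V ω).im ∂μ :=
    (integral_im j1).symm
  have r3 : (∫ ω, U ω * V ω ∂μ).re = ∫ ω, (U ω * V ω).re ∂μ := (integral_re j2).symm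
  have r4 : (∫ ω, U ω * V ω ∂μ).im = ∫ ω, (U ω * V ω).im ∂μ := (integral_im j2).symm
  rw [r1] at e1; rw [r2] at e2; rw [r3] at e3; rw [r4] at e4
  simp only [Complex.mul_re, Complex.mul_im, Complex.conj_re, Complex.conj_im, neg_mul,
    sub_neg_eq_add, Complex.zero_re, Complex.zero_im] at e1 e2 e3 e4
  rw [integral_add i1 i2] at e1
  simp only [← sub_eq_add_neg] at e2
  rw [integral_sub i3 i4] at e2
  rw [integral_sub i1 i2] at e3
  rw [integral_add i3 i4] at e4
  refine ⟨?_, ?_, ?_, ?_⟩ <;> linarith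

end moments

/-! ### Circular Gaussian vectors: linear images, marginals, independence -/

namespace IsCircularGaussian

variable {Ω : Type*} [MeasurableSpace Ω] {μ : Measure Ω} {ι κ : Type*} [Fintype ι] [Fintype κ]
  {X : Ω → ι → ℂ} {C : Matrix ι ι ℂ}

theorem memLp (h : IsCircularGaussian X C μ) (i : ι) : MemLp (fun ω => X ω i) 2 μ :=
  (HasGaussianLaw.eval (X := fun i ω => X ω i) h.gaussian i).memLp_two

theorem aemeasurable (h : IsCircularGaussian X C μ) : AEMeasurable X μ :=
  h.gaussian.aemeasurable

/-- The conjugate sits on the left factor because the covariance convention conjugates the first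
index. -/
theorem mulVec (h : IsCircularGaussian X C μ) (B : Matrix κ ι ℂ) :
    IsCircularGaussian (fun ω => B.mulVec (X ω)) (B.map conj * C * B.transpose) μ := by
  have hint (i : ι) : Integrable (fun ω => X ω i) μ :=
    (HasGaussianLaw.eval (X := fun i ω => X ω i) h.gaussian i).integrable
  refine ⟨?_, ?_, ?_, ?_⟩
  · exact h.gaussian.map_fun
      ((LinearMap.toContinuousLinearMap (Matrix.mulVecLin B)).restrictScalars ℝ)
  · intro a
    simp only [Matrix.mulVec, dotProduct]
    rw [integral_finsetSum _ fun i _ => (hint i).const_mul _]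
    simp [integral_const_mul, h.mean_zero]
  · intro a b
    have hi (i j : ι) : Integrable (fun ω => conj (X ω i) * X ω j) μ :=
      (h.memLp i).star.integrable_mul (h.memLp j)
    have e (ω : Ω) : conj (B.mulVec (X ω) a) * B.mulVec (X ω) b =
        ∑ j, ∑ i, conj (B a i) * B b j * (conj (X ω i) * X ω j) := by
      simp only [Matrix.mulVec, dotProduct, map_sum, map_mul, Finset.sum_mul, Finset.mul_sum]
      exact Finset.sum_congr rfl fun _ _ => Finset.sum_congr rfl fun _ _ => by ring
    simp_rw [e]
    rw [integral_finsetSum _ fun j _ => integrable_finsetSum _ fun i _ => (hi i j).const_mul _]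
    simp only [Matrix.mul_apply, Matrix.map_apply, Matrix.transpose_apply, Finset.sum_mul]
    refine Finset.sum_congr rfl fun j _ => ?_
    rw [integral_finsetSum _ fun i _ => (hi i j).const_mul _]
    refine Finset.sum_congr rfl fun i _ => ?_
    rw [integral_const_mul, h.covariance]
    ring
  · intro a b
    have hi (i j : ι) : Integrable (fun ω => X ω i * X ω j) μ :=
      (h.memLp i).integrable_mul (h.memLp j)
    have e (ω : Ω) : B.mulVec (X ω) a * B.mulVec (X ω) b =
        ∑ j, ∑ i, B a i * B b j * (X ω i * X ω j) := by
      simp only [Matrix.mulVec, dotProduct, Finset.sum_mul, Finset.mul_sum]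
      exact Finset.sum_congr rfl fun _ _ => Finset.sum_congr rfl fun _ _ => by ring
    simp_rw [e]
    rw [integral_finsetSum _ fun j _ => integrable_finsetSum _ fun i _ => (hi i j).const_mul _]
    refine Finset.sum_eq_zero fun j _ => ?_
    rw [integral_finsetSum _ fun i _ => (hi i j).const_mul _]
    refine Finset.sum_eq_zero fun i _ => ?_
    rw [integral_const_mul, h.circular, mul_zero]

theorem comp_index (h : IsCircularGaussian X C μ) (f : κ → ι) :
    IsCircularGaussian (fun ω a => X ω (f a)) (C.submatrix f f) μ where
  gaussian := h.gaussian.map_fun (ContinuousLinearMap.pi fun a => ContinuousLinearMap.proj (f a))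
  mean_zero a := h.mean_zero (f a)
  covariance a b := h.covariance (f a) (f b)
  circular a b := h.circular (f a) (f b)

theorem covariance_re_im (h : IsCircularGaussian X C μ) (i j : ι) :
    cov[fun ω => (X ω i).re, fun ω => (X ω j).re; μ] = (C i j).re / 2 ∧
    cov[fun ω => (X ω i).im, fun ω => (X ω j).im; μ] = (C i j).re / 2 ∧
    cov[fun ω => (X ω i).re, fun ω => (X ω j).im; μ] = (C i j).im / 2 ∧
    cov[fun ω => (X ω i).im, fun ω => (X ω j).re; μ] = -((C i j).im / 2) := by
  have := h.gaussian.isProbabilityMeasure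
  have hint (i : ι) : Integrable (fun ω => X ω i) μ := (h.memLp i).integrable one_le_two
  have mre (i : ι) : ∫ ω, (X ω i).re ∂μ = 0 := by
    have := integral_re (hint i)
    rw [h.mean_zero] at this
    simpa using this
  have mim (i : ι) : ∫ ω, (X ω i).im ∂μ = 0 := by
    have := integral_im (hint i)
    rw [h.mean_zero] at this
    simpa using this
  obtain ⟨h1, h2, h3, h4⟩ :=
    integral_re_im_mul_of_circular (h.memLp i) (h.memLp j) (h.covariance i j) (h.circular i j)
  have lre (i : ι) : MemLp (fun ω => (X ω i).re) 2 μ := (h.memLp i).re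
  have lim (i : ι) : MemLp (fun ω => (X ω i).im) 2 μ := (h.memLp i).im
  refine ⟨?_, ?_, ?_, ?_⟩
  · rw [covariance_eq_sub (lre i) (lre j), mre, zero_mul, sub_zero]; exact h1
  · rw [covariance_eq_sub (lim i) (lim j), mim, zero_mul, sub_zero]; exact h2
  · rw [covariance_eq_sub (lre i) (lim j), mre, zero_mul, sub_zero]; exact h3
  · rw [covariance_eq_sub (lim i) (lre j), mim, zero_mul, sub_zero]; exact h4

theorem re_nonneg_diag (h : IsCircularGaussian X C μ) (i : ι) : 0 ≤ (C i i).re := by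
  have := (h.covariance_re_im i i).1
  have h2 : AEMeasurable (fun ω => (X ω i).re) μ := (h.memLp i).re.aestronglyMeasurable.aemeasurable
  rw [covariance_self h2] at this
  have := variance_nonneg (fun ω => (X ω i).re) μ
  linarith

/-- A real diagonal entry makes the real and imaginary parts uncorrelated, hence independent by
joint Gaussianity; each carries half of the variance. -/
theorem map_eval (h : IsCircularGaussian X C μ) (i : ι) (him : (C i i).im = 0) :
    μ.map (fun ω => X ω i) = cGauss (C i i).re.toNNReal := by
  have := h.gaussian.isProbabilityMeasure
  obtain ⟨h1, h2, h3, h4⟩ := h.covariance_re_im i i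
  have hG : HasGaussianLaw (fun ω => X ω i) μ :=
    HasGaussianLaw.eval (X := fun i ω => X ω i) h.gaussian i
  have hre := hG.map_fun Complex.reCLM
  have him' := hG.map_fun Complex.imCLM
  have hri := hG.map_fun (Complex.reCLM.prod Complex.imCLM)
  simp only [Complex.reCLM_apply, Complex.imCLM_apply, ContinuousLinearMap.prod_apply]
    at hre him' hri
  have hind : IndepFun (fun ω => (X ω i).re) (fun ω => (X ω i).im) μ :=
    hri.indepFun_of_covariance_eq_zero (by rw [h3, him, zero_div])
  have hint : Integrable (fun ω => X ω i) μ := (h.memLp i).integrable one_le_two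
  have mre : ∫ ω, (X ω i).re ∂μ = 0 := by
    have := integral_re hint
    rw [h.mean_zero] at this
    simpa using this
  have mim : ∫ ω, (X ω i).im ∂μ = 0 := by
    have := integral_im hint
    rw [h.mean_zero] at this
    simpa using this
  rw [covariance_self hre.aemeasurable] at h1
  rw [covariance_self him'.aemeasurable] at h2
  have hdiv : ((C i i).re / 2).toNNReal = (C i i).re.toNNReal / 2 := by
    rw [Real.toNNReal_div (h.re_nonneg_diag i)]; simp
  have lre : μ.map (fun ω => (X ω i).re) = gaussianReal 0 ((C i i).re.toNNReal / 2) := by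
    rw [hre.map_eq_gaussianReal, mre, h1, hdiv]
  have lim : μ.map (fun ω => (X ω i).im) = gaussianReal 0 ((C i i).re.toNNReal / 2) := by
    rw [him'.map_eq_gaussianReal, mim, h2, hdiv]
  have hprod := (indepFun_iff_map_prod_eq_prod_map_map hre.aemeasurable him'.aemeasurable).1 hind
  rw [lre, lim] at hprod
  rw [cGauss, ← hprod, AEMeasurable.map_map_of_aemeasurable
    Complex.measurableEquivRealProd.symm.measurable.aemeasurable hri.aemeasurable]
  rfl

/-- By circularity, vanishing complex covariances between the blocks kill all four kinds of real
covariances, and for jointly Gaussian vectors uncorrelated means independent. -/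
theorem indepFun_blocks (h : IsCircularGaussian X C μ) {κ' : Type*} [Fintype κ']
    (f : κ → ι) (g : κ' → ι) (h0 : ∀ a b, C (f a) (g b) = 0) :
    IndepFun (fun ω a => X ω (f a)) (fun ω b => X ω (g b)) μ := by
  have := h.gaussian.isProbabilityMeasure
  let part : Bool → ℂ →L[ℝ] ℝ := fun b => if b then Complex.reCLM else Complex.imCLM
  let U : κ × Bool → Ω → ℝ := fun p ω => part p.2 (X ω (f p.1))
  let V : κ' × Bool → Ω → ℝ := fun p ω => part p.2 (X ω (g p.1))
  let L : (ι → ℂ) →L[ℝ] (κ × Bool → ℝ) × (κ' × Bool → ℝ) :=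
    (ContinuousLinearMap.pi fun p : κ × Bool =>
      (part p.2).comp (ContinuousLinearMap.proj (R := ℝ) (φ := fun _ : ι => ℂ) (f p.1))).prod
      (ContinuousLinearMap.pi fun p : κ' × Bool =>
      (part p.2).comp (ContinuousLinearMap.proj (R := ℝ) (φ := fun _ : ι => ℂ) (g p.1)))
  have hUV : HasGaussianLaw (fun ω => (fun i => U i ω, fun j => V j ω)) μ :=
    h.gaussian.map_fun L
  have hind := hUV.indepFun_of_covariance_eval (by
    rintro ⟨a, _ | _⟩ ⟨b, _ | _⟩
    · exact (h.covariance_re_im (f a) (g b)).2.1.trans (by simp [h0])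
    · exact (h.covariance_re_im (f a) (g b)).2.2.2.trans (by simp [h0])
    · exact (h.covariance_re_im (f a) (g b)).2.2.1.trans (by simp [h0])
    · exact (h.covariance_re_im (f a) (g b)).1.trans (by simp [h0]))
  -- Independence was obtained for the vectors of real coordinates; these maps reassemble the
  -- complex coordinates.
  let rec1 : (κ × Bool → ℝ) → κ → ℂ := fun u a => ⟨u (a, true), u (a, false)⟩
  let rec2 : (κ' × Bool → ℝ) → κ' → ℂ := fun u a => ⟨u (a, true), u (a, false)⟩
  have m1 : Measurable rec1 := measurable_pi_lambda _ fun a => by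
    have : Measurable fun u : κ × Bool → ℝ =>
        Complex.measurableEquivRealProd.symm (u (a, true), u (a, false)) := by fun_prop
    exact this
  have m2 : Measurable rec2 := measurable_pi_lambda _ fun a => by
    have : Measurable fun u : κ' × Bool → ℝ =>
        Complex.measurableEquivRealProd.symm (u (a, true), u (a, false)) := by fun_prop
    exact this
  exact hind.comp m1 m2

end IsCircularGaussian

theorem cGauss_singleton {v : ℝ≥0} (hv : v ≠ 0) (z : ℂ) : cGauss v {z} = 0 := by
  have : NullSingletonClass (gaussianReal 0 (v / 2)) :=
    nullSingletonClass_gaussianReal (div_ne_zero hv two_ne_zero)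
  rw [cGauss, MeasurableEquiv.map_apply]
  have : Complex.measurableEquivRealProd.symm ⁻¹' {z} = {(z.re, z.im)} := by
    ext p
    simp [Complex.ext_iff, Prod.ext_iff]
  rw [this, ← Set.singleton_prod_singleton, Measure.prod_prod]
  simp

/-! ### White Gaussian vectors projected onto subspaces -/

namespace IsCircularGaussian

variable {Ω : Type*} [MeasurableSpace Ω] {μ : Measure Ω} {m d : ℕ} {X : Ω → Fin m → ℂ} {v : ℝ}

theorem of_orthonormal (h : IsCircularGaussian X ((v : ℂ) • (1 : Matrix (Fin m) (Fin m) ℂ)) μ)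
    {b : Fin d → EuclideanSpace ℂ (Fin m)} (hb : Orthonormal ℂ b) :
    IsCircularGaussian (fun ω j => inner ℂ (b j) (WithLp.toLp 2 (X ω)))
      ((v : ℂ) • (1 : Matrix (Fin d) (Fin d) ℂ)) μ := by
  have h1 := h.mulVec (Matrix.of fun (j : Fin d) (i : Fin m) => conj (b j i))
  have e1 : (fun ω j => inner ℂ (b j) (WithLp.toLp 2 (X ω))) =
      fun ω => (Matrix.of fun (j : Fin d) (i : Fin m) => conj (b j i)).mulVec (X ω) := by
    funext ω j
    simp [PiLp.inner_apply, Matrix.mulVec, dotProduct, mul_comm]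
  rw [e1]
  convert h1 using 1
  ext i j
  have := (orthonormal_iff_ite.1 hb) j i
  simp only [PiLp.inner_apply, RCLike.inner_apply] at this
  simp only [Matrix.mul_smul, Matrix.mul_one, Matrix.smul_apply, smul_eq_mul,
    Matrix.mul_apply, Matrix.map_apply, Matrix.of_apply, Complex.conj_conj,
    Matrix.transpose_apply, Matrix.one_apply, mul_assoc, ← Finset.mul_sum, this, eq_comm]

theorem variance_sq_norm_eval {ι : Type*} [Fintype ι] [DecidableEq ι] {Y : Ω → ι → ℂ}
    (h : IsCircularGaussian Y ((v : ℂ) • (1 : Matrix ι ι ℂ)) μ) (j : ι) :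
    Var[fun ω => ‖Y ω j‖ ^ 2; μ] = Var[fun z => ‖z‖ ^ 2; cGauss v.toNNReal] := by
  have hm := h.map_eval j (by simp)
  simp only [Matrix.smul_apply, Matrix.one_apply_eq, smul_eq_mul, mul_one,
    Complex.ofReal_re] at hm
  rw [← hm, variance_map (by fun_prop)
    (HasGaussianLaw.eval (X := fun i ω => Y ω i) h.gaussian j).aemeasurable]
  rfl

theorem integral_sq_norm_eval {ι : Type*} [Fintype ι] {Y : Ω → ι → ℂ} {C : Matrix ι ι ℂ}
    (h : IsCircularGaussian Y C μ) (j : ι) :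
    ∫ ω, ‖Y ω j‖ ^ 2 ∂μ = (C j j).re := by
  have hi : Integrable (fun ω => conj (Y ω j) * Y ω j) μ :=
    (h.memLp j).star.integrable_mul (h.memLp j)
  rw [← h.covariance, ← RCLike.re_eq_complex_re, ← integral_re hi]
  congr 1
  funext ω
  simp [← Complex.normSq_eq_conj_mul_self, Complex.normSq_eq_norm_sq, -Complex.ofReal_pow]

/-- Chebyshev's inequality for a sum of independent terms. The variance of one term is never
evaluated: only its independence of `m` matters later. -/
theorem sum_sq_norm_concentration
    (h : IsCircularGaussian X ((v : ℂ) • (1 : Matrix (Fin m) (Fin m) ℂ)) μ) {δ : ℝ}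
    (hδ : 0 < δ) :
    μ {ω | δ ≤ |∑ j, ‖X ω j‖ ^ 2 - m * v|} ≤
      ENNReal.ofReal (m * Var[fun z => ‖z‖ ^ 2; cGauss v.toNNReal] / δ ^ 2) := by
  have := h.gaussian.isProbabilityMeasure
  have h4 (j : Fin m) : MemLp (fun ω => ‖X ω j‖ ^ 2) 2 μ := by
    -- Gaussian variables have a fourth moment, so their squares have a second one.
    have : MemLp (fun ω => X ω j) 4 μ :=
      (HasGaussianLaw.eval (X := fun i ω => X ω i) h.gaussian j).memLp (by norm_num)
    have h2 := this.norm_rpow_div 2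
    norm_num at h2
    convert h2 using 2
    · rw [ENNReal.eq_div_iff (by norm_num) (by norm_num)]; norm_num
  have hvar : Var[∑ j, fun ω => ‖X ω j‖ ^ 2; μ] =
      m * Var[fun z => ‖z‖ ^ 2; cGauss v.toNNReal] := by
    rw [IndepFun.variance_sum (fun j _ => h4 j)]
    · simp [h.variance_sq_norm_eval]
    · intro i _ j _ hij
      have := h.indepFun_blocks (fun _ : Unit => i) (fun _ : Unit => j) (by
        intro _ _; simp [hij])
      exact this.comp (φ := fun u : Unit → ℂ => ‖u ()‖ ^ 2) (ψ := fun u : Unit → ℂ => ‖u ()‖ ^ 2)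
        (by fun_prop) (by fun_prop)
  have hmean : ∫ ω, (∑ j, fun ω => ‖X ω j‖ ^ 2) ω ∂μ = m * v := by
    simp only [Finset.sum_apply]
    rw [integral_finsetSum _ fun j _ => (h4 j).integrable one_le_two]
    simp [h.integral_sq_norm_eval]
  have := meas_ge_le_variance_div_sq (memLp_finsetSum' Finset.univ fun j _ => h4 j) hδ
  rw [hvar, hmean] at this
  simpa using this

/-- In an orthonormal basis of `V` the projection has `finrank V` white coordinates, so only the
dimension of `V` enters. -/
theorem projection_concentration
    (h : IsCircularGaussian X ((v : ℂ) • (1 : Matrix (Fin m) (Fin m) ℂ)) μ)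
    (V : Submodule ℂ (EuclideanSpace ℂ (Fin m))) {δ : ℝ} (hδ : 0 < δ) :
    μ {ω | δ ≤ |‖V.starProjection (WithLp.toLp 2 (X ω))‖ ^ 2 - Module.finrank ℂ V * v|} ≤
      ENNReal.ofReal
        (Module.finrank ℂ V * Var[fun z => ‖z‖ ^ 2; cGauss v.toNNReal] / δ ^ 2) := by
  let b := stdOrthonormalBasis ℂ V
  have hb : Orthonormal ℂ fun j => (b j : EuclideanSpace ℂ (Fin m)) :=
    b.orthonormal.comp_linearIsometry V.subtypeₗᵢ
  convert (h.of_orthonormal hb).sum_sq_norm_concentration hδ using 5 with ω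
  have := b.sum_sq_norm_inner_right (V.orthogonalProjectionOnto (WithLp.toLp 2 (X ω)))
  rw [Submodule.starProjection_apply, ← Submodule.coe_norm, ← this]
  congr 2
  refine Finset.sum_congr rfl fun j _ => ?_
  simp

/-- A single coordinate of the projection already vanishes with probability zero, its law having no
atoms. -/
theorem projection_ne_zero
    (h : IsCircularGaussian X ((v : ℂ) • (1 : Matrix (Fin m) (Fin m) ℂ)) μ) (hv : 0 < v)
    (V : Submodule ℂ (EuclideanSpace ℂ (Fin m))) (hV : 0 < Module.finrank ℂ V) :
    μ {ω | V.starProjection (WithLp.toLp 2 (X ω)) = 0} = 0 := by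
  let b := stdOrthonormalBasis ℂ V
  have hb : Orthonormal ℂ fun j => (b j : EuclideanSpace ℂ (Fin m)) :=
    b.orthonormal.comp_linearIsometry V.subtypeₗᵢ
  have h1 := h.of_orthonormal hb
  have hm := h1.map_eval ⟨0, hV⟩ (by simp)
  simp only [Matrix.smul_apply, Matrix.one_apply_eq, smul_eq_mul, mul_one,
    Complex.ofReal_re] at hm
  have h0 := cGauss_singleton (v := v.toNNReal) (by simpa using hv) 0
  rw [← hm, Measure.map_apply_of_aemeasurable
    (HasGaussianLaw.eval (X := fun i ω => _) h1.gaussian ⟨0, hV⟩).aemeasurable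
    (measurableSet_singleton _)] at h0
  refine measure_mono_null (fun ω hω => ?_) h0
  simp only [Set.mem_ofPred_eq] at hω
  simp only [Set.mem_preimage, Set.mem_singleton_iff]
  rw [← Submodule.starProjection_eq_self_iff.2 (b ⟨0, hV⟩).2,
    Submodule.inner_starProjection_left_eq_right, hω, inner_zero_right]

end IsCircularGaussian

/-! ### Inverse Gram matrix and distance to the span of the other columns -/

section gram

variable {m n : ℕ}

/-- The `j`-th column of a matrix as a vector of the Euclidean space. -/
def euclCol (A : Matrix (Fin m) (Fin n) ℂ) (j : Fin n) : EuclideanSpace ℂ (Fin m) :=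
  WithLp.toLp 2 fun i => A i j

/-- The span of all columns except the `k`-th one. -/
def otherColSpan (A : Matrix (Fin m) (Fin n) ℂ) (k : Fin n) :
    Submodule ℂ (EuclideanSpace ℂ (Fin m)) :=
  Submodule.span ℂ (Set.range fun j : {j // j ≠ k} => euclCol A j)

theorem euclCol_mem_otherColSpan (A : Matrix (Fin m) (Fin n) ℂ) {j k : Fin n} (h : j ≠ k) :
    euclCol A j ∈ otherColSpan A k :=
  Submodule.subset_span ⟨⟨j, h⟩, rfl⟩

theorem toLp_mulVec (A : Matrix (Fin m) (Fin n) ℂ) (x : Fin n → ℂ) :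
    WithLp.toLp 2 (A.mulVec x) = ∑ j, x j • euclCol A j := by
  ext i
  simp [euclCol, Matrix.mulVec, dotProduct, mul_comm]

theorem toLp_mulVec_sub_mem (A : Matrix (Fin m) (Fin n) ℂ) (x : Fin n → ℂ) (k : Fin n) :
    WithLp.toLp 2 (A.mulVec x) - x k • euclCol A k ∈ otherColSpan A k := by
  rw [toLp_mulVec, ← Finset.add_sum_erase _ _ (Finset.mem_univ k), add_sub_cancel_left]
  exact Submodule.sum_mem _ fun j hj =>
    Submodule.smul_mem _ _ (euclCol_mem_otherColSpan A (Finset.ne_of_mem_erase hj))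

theorem starProjection_orthogonal_mulVec (A : Matrix (Fin m) (Fin n) ℂ) {x : Fin n → ℂ}
    {k : Fin n} (hx : x k = 1) :
    (otherColSpan A k)ᗮ.starProjection (WithLp.toLp 2 (A.mulVec x)) =
      (otherColSpan A k)ᗮ.starProjection (euclCol A k) := by
  have h := toLp_mulVec_sub_mem A x k
  rw [hx, one_smul] at h
  have h0 : (otherColSpan A k)ᗮ.starProjection
      (WithLp.toLp 2 (A.mulVec x) - euclCol A k) = 0 := by
    rw [Submodule.starProjection_apply_eq_zero_iff]
    exact Submodule.le_orthogonal_orthogonal _ h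
  rwa [map_sub, sub_eq_zero] at h0

theorem inner_euclCol_mulVec (A : Matrix (Fin m) (Fin n) ℂ) (j : Fin n) (x : Fin n → ℂ) :
    inner ℂ (euclCol A j) (WithLp.toLp 2 (A.mulVec x)) = (A.conjTranspose * A).mulVec x j := by
  rw [← Matrix.mulVec_mulVec]
  simp [euclCol, PiLp.inner_apply, Matrix.mulVec, dotProduct, mul_comm]

/-- With `g` the `k`-th column of the inverse Gram matrix, `u = A g` is orthogonal to every column
but the `k`-th, and has inner product `1` with that one. Pairing `u` with itself gives `‖u‖² = g k`,
and the component of column `k` orthogonal to the others is `u / g k`. -/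
theorem gram_inv_diag {A : Matrix (Fin m) (Fin n) ℂ} (hA : (A.conjTranspose * A).det ≠ 0)
    (k : Fin n) :
    (((A.conjTranspose * A)⁻¹ k k).im = 0 ∧ 0 < ((A.conjTranspose * A)⁻¹ k k).re) ∧
    ‖(otherColSpan A k)ᗮ.starProjection (euclCol A k)‖ ^ 2 =
      (((A.conjTranspose * A)⁻¹ k k).re)⁻¹ := by
  set G := A.conjTranspose * A with hG
  set g : Fin n → ℂ := fun j => G⁻¹ j k with hg
  set u := WithLp.toLp 2 (A.mulVec g) with hu
  have hin (j : Fin n) : inner ℂ (euclCol A j) u = if j = k then 1 else 0 := by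
    rw [hu, inner_euclCol_mulVec, ← hG]
    have : G * G⁻¹ = 1 := Matrix.mul_nonsing_inv _ (isUnit_iff_ne_zero.2 hA)
    have h2 := congrFun (congrFun this j) k
    rw [Matrix.one_apply] at h2
    rw [← h2]
    rfl
  have huu : inner ℂ u u = conj (g k) := by
    have hsum : u = ∑ j, g j • euclCol A j := toLp_mulVec A g
    calc inner ℂ u u = inner ℂ (∑ j, g j • euclCol A j) u := by rw [← hsum]
      _ = conj (g k) := by simp [hin]
  have hreal : g k = ((‖u‖ ^ 2 : ℝ) : ℂ) := by
    have := inner_self_eq_norm_sq_to_K (𝕜 := ℂ) u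
    rw [huu] at this
    rw [← Complex.conj_conj (g k), this]
    simp
  have hu0 : u ≠ 0 := by
    intro h0
    have := hin k
    rw [h0] at this
    simp at this
  have hupos : 0 < ‖u‖ ^ 2 := by positivity
  have hgk : G⁻¹ k k = ((‖u‖ ^ 2 : ℝ) : ℂ) := hreal
  have hg0 : g k ≠ 0 := by rw [hreal]; exact_mod_cast hupos.ne'
  have hproj : (otherColSpan A k)ᗮ.starProjection (euclCol A k) = (g k)⁻¹ • u := by
    apply Submodule.eq_starProjection_of_mem_orthogonal
    · refine Submodule.smul_mem _ _ ?_
      rw [Submodule.mem_orthogonal]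
      intro w hw
      induction hw using Submodule.span_induction with
      | mem w hw =>
        obtain ⟨j, rfl⟩ := hw
        simp [hin, j.2]
      | zero => simp
      | add x y _ _ hx hy => rw [inner_add_left, hx, hy, add_zero]
      | smul c x _ hx => rw [inner_smul_left, hx, mul_zero]
    · refine Submodule.le_orthogonal_orthogonal _ ?_
      have h := toLp_mulVec_sub_mem A g k
      -- Column `k` minus `u / g k` is `-(g k)⁻¹` times `u - g k • euclCol A k`, a combination of
      -- the other columns.
      have h2 := Submodule.smul_mem _ (-(g k)⁻¹) h
      rw [smul_sub, smul_smul, neg_mul, inv_mul_cancel₀ hg0] at h2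
      convert h2 using 1
      simp [hu]
      abel
  refine ⟨⟨by rw [hgk, Complex.ofReal_im], by rw [hgk, Complex.ofReal_re]; exact hupos⟩, ?_⟩
  rw [hproj, norm_smul, norm_inv, hgk, Complex.ofReal_re, hreal, Complex.norm_real,
    Real.norm_of_nonneg hupos.le]
  field_simp

theorem linearIndependent_euclCol_of_gram {A : Matrix (Fin m) (Fin n) ℂ}
    (hA : (A.conjTranspose * A).det ≠ 0) : LinearIndependent ℂ (euclCol A) := by
  rw [Fintype.linearIndependent_iff]
  intro x hx
  rw [← toLp_mulVec] at hx
  have h0 : A.mulVec x = 0 := by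
    have := congrArg WithLp.ofLp hx
    simpa using this
  have h1 : (A.conjTranspose * A).mulVec x = 0 := by
    rw [← Matrix.mulVec_mulVec, h0, Matrix.mulVec_zero]
  have := Matrix.eq_zero_of_mulVec_eq_zero hA h1
  exact fun i => congrFun this i

theorem finrank_otherColSpan_orthogonal {A : Matrix (Fin m) (Fin n) ℂ}
    (hA : (A.conjTranspose * A).det ≠ 0) (k : Fin n) :
    (Module.finrank ℂ (otherColSpan A k)ᗮ : ℝ) = m - n + 1 := by
  have hli : LinearIndependent ℂ fun j : {j // j ≠ k} => euclCol A j :=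
    (linearIndependent_euclCol_of_gram hA).comp _ Subtype.val_injective
  have h1 : Module.finrank ℂ (otherColSpan A k) = Fintype.card {j // j ≠ k} :=
    finrank_span_eq_card hli
  have h2 := (otherColSpan A k).finrank_add_finrank_orthogonal
  rw [h1, finrank_euclideanSpace_fin, Fintype.card_subtype_compl, Fintype.card_fin] at h2
  simp only [Fintype.card_unique] at h2
  have hn : 1 ≤ n := k.pos
  have : (Module.finrank ℂ (otherColSpan A k)ᗮ) + n = m + 1 := by omega
  have := congrArg (Nat.cast (R := ℝ)) this
  push_cast at this
  linarith

/-- No independence of the columns is assumed: dependence only enlarges the complement. This is what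
allows nonsingularity of the Gram matrix to be deduced from it. -/
theorem finrank_otherColSpan_orthogonal_pos (A : Matrix (Fin m) (Fin n) ℂ) (h : n ≤ m)
    (k : Fin n) : 0 < Module.finrank ℂ (otherColSpan A k)ᗮ := by
  have h1 : Module.finrank ℂ (otherColSpan A k) ≤ Fintype.card {j // j ≠ k} :=
    finrank_range_le_card _
  have h2 := (otherColSpan A k).finrank_add_finrank_orthogonal
  rw [finrank_euclideanSpace_fin] at h2
  rw [Fintype.card_subtype_compl, Fintype.card_fin] at h1
  simp only [Fintype.card_unique] at h1
  have hn : 1 ≤ n := k.pos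
  omega

open scoped ComplexOrder in
-- A kernel vector with a nonzero `k`-th coordinate would express column `k` through the others.
theorem gram_det_ne_zero {A : Matrix (Fin m) (Fin n) ℂ}
    (h : ∀ k, (otherColSpan A k)ᗮ.starProjection (euclCol A k) ≠ 0) :
    (A.conjTranspose * A).det ≠ 0 := by
  intro h0
  obtain ⟨x, hx, hx0⟩ := Matrix.exists_mulVec_eq_zero_iff.2 h0
  obtain ⟨k, hk⟩ := Function.ne_iff.1 hx
  simp only [Pi.zero_apply] at hk
  rw [Matrix.conjTranspose_mul_self_mulVec_eq_zero] at hx0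
  have h1 := starProjection_orthogonal_mulVec A (x := (x k)⁻¹ • x) (k := k) (by simp [hk])
  rw [Matrix.mulVec_smul, hx0, smul_zero, WithLp.toLp_zero, map_zero] at h1
  exact h k h1.symm

end gram

/-! ### Innovations of the Kac–Murdock–Szegő matrix -/

section kms

variable {n : ℕ} {ρ : ℂ}

theorem kmsMatrix_apply_add (i j : Fin n) (d : ℕ) (h : (j : ℕ) = i + d) :
    kmsMatrix n ρ i j = ρ ^ d ∧ kmsMatrix n ρ j i = conj ρ ^ d := by
  have hij : i ≤ j := by rw [Fin.le_def]; omega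
  constructor
  · simp [kmsMatrix, hij, h]
  · rcases Nat.eq_zero_or_pos d with rfl | hd
    · have : i = j := by ext; omega
      subst this
      simp [kmsMatrix]
    · have : ¬ j ≤ i := by rw [Fin.le_def]; omega
      simp [kmsMatrix, this, h]

/-- The correlation is that of a first-order autoregression, so the best linear interpolation of one
entry from all the others uses only its two neighbours; `t` is the residual of this interpolation
and the scalar is its variance. -/
theorem kms_interior (k : Fin n) (h0 : 0 < (k : ℕ)) (h1 : (k : ℕ) + 1 < n) :
    ∃ t : Fin n → ℂ, t k = 1 ∧ (kmsMatrix n ρ).mulVec t =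
      Pi.single k (((1 - ‖ρ‖ ^ 2) / (1 + ‖ρ‖ ^ 2) : ℝ) : ℂ) := by
  let p : Fin n := ⟨k - 1, by omega⟩
  let q : Fin n := ⟨k + 1, h1⟩
  have hp : p ≠ k := by intro h; have := congrArg Fin.val h; simp [p] at this; omega
  have hq : q ≠ k := by intro h; have := congrArg Fin.val h; simp [q] at this
  have hD : (1 + ρ * conj ρ) ≠ 0 := by
    rw [Complex.mul_conj]
    have : (0 : ℝ) < 1 + Complex.normSq ρ := by have := Complex.normSq_nonneg ρ; linarith
    exact_mod_cast this.ne'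
  have hn : ((‖ρ‖ : ℂ)) ^ 2 = ρ * conj ρ := by rw [Complex.mul_conj']
  refine ⟨Pi.single k 1 + Pi.single p (-ρ / (1 + ρ * conj ρ)) +
    Pi.single q (-conj ρ / (1 + ρ * conj ρ)), by simp [hp.symm, hq.symm], ?_⟩
  funext m
  simp only [Matrix.mulVec_add, Matrix.mulVec_single, Pi.add_apply, Pi.smul_apply,
    Matrix.col_apply, MulOpposite.smul_eq_mul_unop, MulOpposite.unop_op, mul_one]
  rcases lt_trichotomy m k with h | h | h
  · rw [Fin.lt_def] at h
    obtain ⟨d, hd⟩ := Nat.exists_eq_add_of_lt h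
    rw [(kmsMatrix_apply_add m k (d + 1) (by omega)).1,
      (kmsMatrix_apply_add m p d (by simp [p]; omega)).1,
      (kmsMatrix_apply_add m q (d + 2) (by simp [q]; omega)).1,
      Pi.single_eq_of_ne (by intro e; subst e; omega)]
    field_simp
    ring
  · subst h
    rw [(kmsMatrix_apply_add m m 0 (by omega)).1,
      (kmsMatrix_apply_add p m 1 (by simp [p]; omega)).2,
      (kmsMatrix_apply_add m q 1 (by simp [q])).1, Pi.single_eq_same]
    push_cast
    rw [hn]
    generalize conj ρ = c at hD ⊢
    rw [pow_zero, pow_one, pow_one, mul_div_assoc', mul_div_assoc', eq_div_iff hD, add_mul,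
      add_mul, div_mul_cancel₀ _ hD, div_mul_cancel₀ _ hD]
    ring
  · rw [Fin.lt_def] at h
    obtain ⟨d, hd⟩ := Nat.exists_eq_add_of_lt h
    rw [(kmsMatrix_apply_add k m (d + 1) (by omega)).2,
      (kmsMatrix_apply_add p m (d + 2) (by simp [p]; omega)).2,
      (kmsMatrix_apply_add q m d (by simp [q]; omega)).2,
      Pi.single_eq_of_ne (by intro e; subst e; omega)]
    field_simp
    ring

/-- At an end there is only one neighbour, and the residual variance is larger than in the interior.
-/
theorem kms_first (k : Fin n) (h0 : (k : ℕ) = 0) (h1 : 1 < n) :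
    ∃ t : Fin n → ℂ, t k = 1 ∧ (kmsMatrix n ρ).mulVec t =
      Pi.single k ((1 - ‖ρ‖ ^ 2 : ℝ) : ℂ) := by
  let q : Fin n := ⟨1, h1⟩
  have hq : q ≠ k := by intro h; have := congrArg Fin.val h; simp [q] at this; omega
  have hn : ((‖ρ‖ : ℂ)) ^ 2 = ρ * conj ρ := by rw [Complex.mul_conj']
  refine ⟨Pi.single k 1 + Pi.single q (-conj ρ), by simp [hq.symm], ?_⟩
  funext m
  simp only [Matrix.mulVec_add, Matrix.mulVec_single, Pi.add_apply, Pi.smul_apply,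
    Matrix.col_apply, MulOpposite.smul_eq_mul_unop, MulOpposite.unop_op, mul_one]
  by_cases h : m = k
  · subst h
    rw [(kmsMatrix_apply_add m m 0 (by omega)).1,
      (kmsMatrix_apply_add m q 1 (by simp [q]; omega)).1, Pi.single_eq_same]
    push_cast
    rw [hn]
    ring
  · have hm : 0 < (m : ℕ) := by
      by_contra hm
      exact h (by ext; omega)
    obtain ⟨d, hd⟩ := Nat.exists_eq_add_of_lt hm
    rw [(kmsMatrix_apply_add k m (d + 1) (by omega)).2,
      (kmsMatrix_apply_add q m d (by simp [q]; omega)).2, Pi.single_eq_of_ne h]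
    ring

theorem kms_last (k : Fin n) (h0 : (k : ℕ) + 1 = n) (h1 : 1 < n) :
    ∃ t : Fin n → ℂ, t k = 1 ∧ (kmsMatrix n ρ).mulVec t =
      Pi.single k ((1 - ‖ρ‖ ^ 2 : ℝ) : ℂ) := by
  let p : Fin n := ⟨k - 1, by omega⟩
  have hp : p ≠ k := by intro h; have := congrArg Fin.val h; simp [p] at this; omega
  have hn : ((‖ρ‖ : ℂ)) ^ 2 = ρ * conj ρ := by rw [Complex.mul_conj']
  refine ⟨Pi.single k 1 + Pi.single p (-ρ), by simp [hp.symm], ?_⟩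
  funext m
  simp only [Matrix.mulVec_add, Matrix.mulVec_single, Pi.add_apply, Pi.smul_apply,
    Matrix.col_apply, MulOpposite.smul_eq_mul_unop, MulOpposite.unop_op, mul_one]
  by_cases h : m = k
  · subst h
    rw [(kmsMatrix_apply_add m m 0 (by omega)).1,
      (kmsMatrix_apply_add p m 1 (by simp [p]; omega)).2, Pi.single_eq_same]
    push_cast
    rw [hn]
    ring
  · have hm : (m : ℕ) < k := by
      by_contra hm
      exact h (by ext; omega)
    obtain ⟨d, hd⟩ := Nat.exists_eq_add_of_lt hm
    rw [(kmsMatrix_apply_add m k (d + 1) (by omega)).1,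
      (kmsMatrix_apply_add m p d (by simp [p]; omega)).1, Pi.single_eq_of_ne h]
    ring

/-- Every column of the channel has a nondegenerate innovation with respect to the others. -/
theorem kms_innovation (hρ : ‖ρ‖ < 1) (hn : 1 < n) (k : Fin n) :
    ∃ (τ : ℝ) (t : Fin n → ℂ), 0 < τ ∧ t k = 1 ∧
      (kmsMatrix n ρ).mulVec t = Pi.single k (τ : ℂ) := by
  have h2 : ‖ρ‖ ^ 2 < 1 := by nlinarith [norm_nonneg ρ]
  have h3 : 0 < (1 - ‖ρ‖ ^ 2) / (1 + ‖ρ‖ ^ 2) := div_pos (by linarith) (by positivity)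
  rcases Nat.eq_zero_or_pos (k : ℕ) with h | h
  · obtain ⟨t, ht⟩ := kms_first (ρ := ρ) k h hn
    exact ⟨_, t, by linarith, ht⟩
  · rcases eq_or_ne ((k : ℕ) + 1) n with h' | h'
    · obtain ⟨t, ht⟩ := kms_last (ρ := ρ) k h' hn
      exact ⟨_, t, by linarith, ht⟩
    · obtain ⟨t, ht⟩ := kms_interior (ρ := ρ) k h (by have := k.2; omega)
      exact ⟨_, t, h3, ht⟩

end kms

/-! ### Measurability, and rebuilding a matrix from an innovation -/

section entries

variable {m n : ℕ}

/-- The matrix with the given family of entries. -/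
def entryMatrix (x : Fin m × Fin n → ℂ) : Matrix (Fin m) (Fin n) ℂ :=
  Matrix.of fun i j => x (i, j)

theorem continuous_entryMatrix : Continuous (entryMatrix (m := m) (n := n)) := by
  unfold entryMatrix
  fun_prop

/-- The Gram matrix of the matrix with entries `x`. -/
def entryGram (x : Fin m × Fin n → ℂ) : Matrix (Fin n) (Fin n) ℂ :=
  (entryMatrix x).conjTranspose * entryMatrix x

theorem continuous_entryGram : Continuous (entryGram (m := m) (n := n)) :=
  continuous_entryMatrix.matrix_conjTranspose.matrix_mul continuous_entryMatrix

theorem measurable_det_entryGram : Measurable fun x : Fin m × Fin n → ℂ => (entryGram x).det :=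
  continuous_entryGram.matrix_det.measurable

theorem measurable_entryGram_inv (i j : Fin n) :
    Measurable fun x : Fin m × Fin n → ℂ => (entryGram x)⁻¹ i j := by
  simp only [Matrix.inv_def, Ring.inverse_eq_inv', Matrix.smul_apply, smul_eq_mul]
  exact measurable_det_entryGram.inv.mul
    (continuous_entryGram.matrix_adjugate.matrix_elem i j).measurable

/-- Linear dependence of column `k` on the others describes the image of a continuous map on a
σ-compact space, hence a countable union of compact sets. This avoids measuring a projection whose
subspace varies. -/
theorem measurableSet_projection_eq_zero (k : Fin n) :
    MeasurableSet {x : Fin m × Fin n → ℂ |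
      (otherColSpan (entryMatrix x) k)ᗮ.starProjection (euclCol (entryMatrix x) k) = 0} := by
  -- `F` overwrites column `k` by the combination of the other columns with coefficients `q.2`.
  let F : (Fin m × Fin n → ℂ) × (Fin n → ℂ) → (Fin m × Fin n → ℂ) := fun q p =>
    if p.2 = k then ∑ j : {j // j ≠ k}, q.2 j * q.1 (p.1, j) else q.1 p
  have hF : Continuous F := by
    refine continuous_pi fun p => ?_
    by_cases h : p.2 = k
    · simp only [F, h, if_true]; fun_prop
    · simp only [F, h, if_false]; fun_prop
  have hset : {x : Fin m × Fin n → ℂ |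
      (otherColSpan (entryMatrix x) k)ᗮ.starProjection (euclCol (entryMatrix x) k) = 0} =
      Set.range F := by
    ext x
    rw [Set.mem_ofPred_eq, Submodule.starProjection_apply_eq_zero_iff,
      Submodule.orthogonal_orthogonal, otherColSpan, Submodule.mem_span_range_iff_exists_fun]
    constructor
    · rintro ⟨c, hc⟩
      refine ⟨(x, fun j => if h : j ≠ k then c ⟨j, h⟩ else 0), ?_⟩
      funext ⟨i, j⟩
      by_cases h : j = k
      · subst h
        have := congrArg (fun v : EuclideanSpace ℂ (Fin m) => v i) hc
        simp only [euclCol, entryMatrix, WithLp.ofLp_sum, WithLp.ofLp_smul, Finset.sum_apply,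
          Pi.smul_apply, Matrix.of_apply, smul_eq_mul] at this
        simp only [F, if_true, ← this]
        exact Finset.sum_congr rfl fun a _ => by simp [a.2]
      · simp [F, h]
    · rintro ⟨⟨y, c⟩, rfl⟩
      refine ⟨fun j => c j, ?_⟩
      ext i
      simp only [euclCol, entryMatrix, WithLp.ofLp_sum, WithLp.ofLp_smul, Finset.sum_apply,
        Pi.smul_apply, Matrix.of_apply, smul_eq_mul, F, if_true]
      exact Finset.sum_congr rfl fun a _ => by simp [a.2]
  rw [hset]
  obtain ⟨K, hK, hU⟩ := isSigmaCompact_range hF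
  rw [← hU]
  exact MeasurableSet.iUnion fun i => (hK i).measurableSet

/-- Rebuild a matrix from its columns other than the `k`-th and the combination `e` of its columns
with coefficients `t`, where `t k = 1`. -/
def rebuild (k : Fin n) (t : Fin n → ℂ) (o : Fin m × {j // j ≠ k} → ℂ) (e : Fin m → ℂ) :
    Fin m × Fin n → ℂ := fun p =>
  if h : p.2 = k then e p.1 - ∑ j : {j // j ≠ k}, t j * o (p.1, j) else o (p.1, ⟨p.2, h⟩)

variable {k : Fin n} {t : Fin n → ℂ}

theorem continuous_rebuild :
    Continuous fun q : (Fin m × {j // j ≠ k} → ℂ) × (Fin m → ℂ) => rebuild k t q.1 q.2 := by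
  refine continuous_pi fun p => ?_
  by_cases h : p.2 = k
  · simp only [rebuild, h, dif_pos]; fun_prop
  · simp only [rebuild, h, dif_neg, not_false_eq_true]; fun_prop

theorem sum_split_at (k : Fin n) (f : Fin n → ℂ) :
    ∑ j, f j = f k + ∑ j : {j // j ≠ k}, f j := by
  rw [← Finset.add_sum_erase _ _ (Finset.mem_univ k)]
  congr 1
  exact Finset.sum_subtype _ (by simp) f

theorem rebuild_mulVec (ht : t k = 1) (o : Fin m × {j // j ≠ k} → ℂ) (e : Fin m → ℂ) :
    (entryMatrix (rebuild k t o e)).mulVec t = e := by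
  funext i
  rw [Matrix.mulVec, dotProduct, sum_split_at k]
  have : ∑ j : {j // j ≠ k}, entryMatrix (rebuild k t o e) i j * t j =
      ∑ j : {j // j ≠ k}, t j * o (i, j) :=
    Finset.sum_congr rfl fun j _ => by simp [entryMatrix, rebuild, j.2, mul_comm]
  rw [this]
  simp [entryMatrix, rebuild, ht]

theorem rebuild_self (ht : t k = 1) (A : Matrix (Fin m) (Fin n) ℂ) :
    rebuild k t (fun p => A p.1 p.2) (A.mulVec t) = fun p => A p.1 p.2 := by
  funext ⟨i, j⟩
  by_cases h : j = k
  · subst h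
    simp only [rebuild, dif_pos, Matrix.mulVec, dotProduct]
    rw [sum_split_at j, ht]
    simp [mul_comm]
  · simp [rebuild, h]

/-- The span does not involve `e`: once the other columns are frozen, it is a deterministic subspace
onto whose complement an independent vector is projected. -/
theorem otherColSpan_rebuild (o : Fin m × {j // j ≠ k} → ℂ) (e : Fin m → ℂ) :
    otherColSpan (entryMatrix (rebuild k t o e)) k =
      Submodule.span ℂ (Set.range fun j => WithLp.toLp 2 fun i => o (i, j)) := by
  unfold otherColSpan
  congr 2
  funext j
  ext i
  simp [euclCol, entryMatrix, rebuild, j.2]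

end entries

/-! ### Nonsingularity and concentration for the random channel -/

section channel

variable {Ω : Type*} [MeasurableSpace Ω] {μ : Measure Ω} {m n : ℕ}
  {H : Ω → Matrix (Fin m) (Fin n) ℂ} {C : Matrix (Fin n) (Fin n) ℂ} {k : Fin n}
  {t : Fin n → ℂ} {τ : ℝ}

/-- Pairing any entry of `H` with `H t` produces an entry of `C t`, which is supported at `k`. Hence
the other columns are uncorrelated with `H t`, while `t k = 1` leaves variance `τ`. -/
theorem innovation_law
    (hH : IsCircularGaussian (fun ω (p : Fin m × Fin n) => H ω p.1 p.2)
      (Matrix.kronecker (1 : Matrix (Fin m) (Fin m) ℂ) C) μ)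
    (ht : t k = 1) (hC : C.mulVec t = Pi.single k (τ : ℂ)) :
    IsCircularGaussian (fun ω => (H ω).mulVec t)
      ((τ : ℂ) • (1 : Matrix (Fin m) (Fin m) ℂ)) μ ∧
    IndepFun (fun ω (p : Fin m × {j // j ≠ k}) => H ω p.1 p.2) (fun ω => (H ω).mulVec t) μ := by
  -- The other columns and `H t` are stacked into one linear image of `H`, so that they are jointly
  -- Gaussian.
  let B : Matrix ((Fin m × {j // j ≠ k}) ⊕ Fin m) (Fin m × Fin n) ℂ :=
    Matrix.of (Sum.elim (fun p => Pi.single (p.1, p.2.1) 1)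
      (fun r q => if q.1 = r then t q.2 else 0))
  obtain ⟨K, hKeq⟩ : ∃ K, K = Matrix.kronecker (1 : Matrix (Fin m) (Fin m) ℂ) C := ⟨_, rfl⟩
  have hK (q q' : Fin m × Fin n) : K q q' = (if q.1 = q'.1 then 1 else 0) * C q.2 q'.2 := by
    rw [hKeq, ← Matrix.one_apply]; rfl
  rw [← hKeq] at hH
  have h := hH.mulVec B
  have hcov (a : (Fin m × {j // j ≠ k}) ⊕ Fin m) (r : Fin m) :
      (B.map conj * K * B.transpose) a (Sum.inr r)
        = conj (B a (r, k)) * τ := by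
    have h1 (q : Fin m × Fin n) :
        (K * B.transpose) q (Sum.inr r) =
          if q = (r, k) then (τ : ℂ) else 0 := by
      have h2 : C.mulVec t q.2 = if q.2 = k then (τ : ℂ) else 0 := by
        rw [hC, Pi.single_apply]
      rw [Matrix.mul_apply, Fintype.sum_prod_type]
      simp only [hK, Matrix.transpose_apply, B,
        Matrix.of_apply, Sum.elim_inr, ite_mul, one_mul, zero_mul, mul_ite, mul_zero]
      rw [Finset.sum_eq_single q.1 (by
        intro b _ hb
        simp [Ne.symm hb]) (by simp)]
      simp only [if_true]
      by_cases hq : q.1 = r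
      · simp only [hq, if_true]
        rw [Matrix.mulVec, dotProduct] at h2
        rw [h2]
        simp [Prod.ext_iff, hq]
      · simp [hq, Prod.ext_iff]
    rw [Matrix.mul_assoc, Matrix.mul_apply]
    simp [h1]
  have hinl (ω : Ω) (p : Fin m × {j // j ≠ k}) :
      B.mulVec (fun p : Fin m × Fin n => H ω p.1 p.2) (Sum.inl p) = H ω p.1 p.2 := by
    simp [B, Matrix.mulVec, dotProduct, Pi.single_apply]
  have hinr (ω : Ω) (r : Fin m) :
      B.mulVec (fun p : Fin m × Fin n => H ω p.1 p.2) (Sum.inr r) = (H ω).mulVec t r := by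
    simp only [B, Matrix.mulVec, dotProduct, Matrix.of_apply, Sum.elim_inr,
      Fintype.sum_prod_type, ite_mul, zero_mul]
    rw [Finset.sum_eq_single r (by intro b _ hb; simp [hb]) (by simp)]
    simp [mul_comm]
  constructor
  · have h1 := h.comp_index (Sum.inr : Fin m → (Fin m × {j // j ≠ k}) ⊕ Fin m)
    simp only [hinr] at h1
    convert h1 using 1
    ext a b
    rw [Matrix.submatrix_apply, hcov]
    by_cases hab : a = b
    · simp [B, hab, ht]
    · simp [B, hab, Ne.symm hab]
  · have h1 := h.indepFun_blocks (Sum.inl : _ → (Fin m × {j // j ≠ k}) ⊕ Fin m) Sum.inr (by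
      intro p r
      rw [hcov]
      have : (p.2 : Fin n) ≠ k := p.2.2
      simp [B, Prod.ext_iff, this.symm])
    simpa only [hinl, hinr] using h1

/-- Fubini: a bound over the innovation alone, uniform in the frozen other columns `o`, passes to
the whole channel. -/
theorem channel_measure_le
    (hH : IsCircularGaussian (fun ω (p : Fin m × Fin n) => H ω p.1 p.2)
      (Matrix.kronecker (1 : Matrix (Fin m) (Fin m) ℂ) C) μ)
    (ht : t k = 1) (hC : C.mulVec t = Pi.single k (τ : ℂ))
    {B : Set (Fin m × Fin n → ℂ)} (hB : MeasurableSet B) {c : ℝ≥0∞}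
    (hc : ∀ o, μ {ω | rebuild k t o ((H ω).mulVec t) ∈ B} ≤ c) :
    μ {ω | (fun p : Fin m × Fin n => H ω p.1 p.2) ∈ B} ≤ c := by
  have := hH.gaussian.isProbabilityMeasure
  obtain ⟨hE, hind⟩ := innovation_law hH ht hC
  have hO : AEMeasurable (fun ω (p : Fin m × {j // j ≠ k}) => H ω p.1 p.2) μ :=
    (hH.comp_index fun p : Fin m × {j // j ≠ k} => (p.1, p.2.1)).aemeasurable
  have hOE := (indepFun_iff_map_prod_eq_prod_map_map hO hE.aemeasurable).1 hind
  have hR : Measurable fun q : (Fin m × {j // j ≠ k} → ℂ) × (Fin m → ℂ) =>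
    rebuild k t q.1 q.2 := continuous_rebuild.measurable
  have : IsProbabilityMeasure (μ.map fun ω (p : Fin m × {j // j ≠ k}) => H ω p.1 p.2) :=
    Measure.isProbabilityMeasure_map hO
  have : IsProbabilityMeasure (μ.map fun ω => (H ω).mulVec t) :=
    Measure.isProbabilityMeasure_map hE.aemeasurable
  have h1 : μ {ω | (fun p : Fin m × Fin n => H ω p.1 p.2) ∈ B} =
      μ.map (fun ω => ((fun p : Fin m × {j // j ≠ k} => H ω p.1 p.2), (H ω).mulVec t))
        ((fun q => rebuild k t q.1 q.2) ⁻¹' B) := by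
    rw [Measure.map_apply_of_aemeasurable (hO.prodMk hE.aemeasurable) (hR hB)]
    congr 1
    ext ω
    simp only [Set.mem_preimage, Set.mem_ofPred_eq]
    rw [rebuild_self ht]
  rw [h1, hOE, Measure.prod_apply (hR hB)]
  refine (lintegral_mono fun o => ?_).trans (lintegral_const c).le |>.trans (by simp)
  rw [Measure.map_apply_of_aemeasurable hE.aemeasurable
    (measurable_prodMk_left (hR hB))]
  exact hc o

theorem channel_projection_ne_zero
    (hH : IsCircularGaussian (fun ω (p : Fin m × Fin n) => H ω p.1 p.2)
      (Matrix.kronecker (1 : Matrix (Fin m) (Fin m) ℂ) C) μ)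
    (hτ : 0 < τ) (ht : t k = 1) (hC : C.mulVec t = Pi.single k (τ : ℂ)) (hmn : n ≤ m) :
    μ {ω | (otherColSpan (H ω) k)ᗮ.starProjection (euclCol (H ω) k) = 0} = 0 := by
  have h := channel_measure_le hH ht hC (measurableSet_projection_eq_zero k) (c := 0) (by
    intro o
    obtain ⟨hE, -⟩ := innovation_law hH ht hC
    have hpos := finrank_otherColSpan_orthogonal_pos
      (entryMatrix (rebuild k t o (fun _ => 0))) hmn k
    rw [otherColSpan_rebuild] at hpos
    refine (measure_mono fun ω hω => ?_).trans (hE.projection_ne_zero hτ _ hpos).le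
    rw [Set.mem_ofPred_eq, Set.mem_ofPred_eq, ← starProjection_orthogonal_mulVec _ ht,
      rebuild_mulVec ht, otherColSpan_rebuild] at hω
    exact hω)
  exact nonpos_iff_eq_zero.1 h

theorem channel_gram_det_ne_zero
    (hH : IsCircularGaussian (fun ω (p : Fin m × Fin n) => H ω p.1 p.2)
      (Matrix.kronecker (1 : Matrix (Fin m) (Fin m) ℂ) C) μ) (hmn : n ≤ m)
    (hC : ∀ k : Fin n, ∃ (τ : ℝ) (t : Fin n → ℂ), 0 < τ ∧ t k = 1 ∧
      C.mulVec t = Pi.single k (τ : ℂ)) :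
    μ {ω | ((H ω).conjTranspose * H ω).det = 0} = 0 := by
  refine measure_mono_null (t := ⋃ k, {ω | (otherColSpan (H ω) k)ᗮ.starProjection
    (euclCol (H ω) k) = 0}) (fun ω hω => ?_) (measure_iUnion_null fun k => ?_)
  · by_contra hcon
    simp only [Set.mem_iUnion, Set.mem_ofPred_eq, not_exists] at hcon
    exact gram_det_ne_zero hcon hω
  · obtain ⟨τ, t, hτ, ht, hCt⟩ := hC k
    exact channel_projection_ne_zero hH hτ ht hCt hmn

theorem channel_gram_inv_concentration
    (hH : IsCircularGaussian (fun ω (p : Fin m × Fin n) => H ω p.1 p.2)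
      (Matrix.kronecker (1 : Matrix (Fin m) (Fin m) ℂ) C) μ)
    (ht : t k = 1) (hC : C.mulVec t = Pi.single k (τ : ℂ)) {δ : ℝ} (hδ : 0 < δ) :
    μ {ω | ((H ω).conjTranspose * H ω).det ≠ 0 ∧
        δ ≤ |((((H ω).conjTranspose * H ω)⁻¹ k k).re)⁻¹ - ((m : ℝ) - n + 1) * τ|} ≤
      ENNReal.ofReal
        (((m : ℝ) - n + 1) * Var[fun z => ‖z‖ ^ 2; cGauss τ.toNNReal] / δ ^ 2) := by
  have hmeas : MeasurableSet {x : Fin m × Fin n → ℂ | (entryGram x).det ≠ 0 ∧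
      δ ≤ |(((entryGram x)⁻¹ k k).re)⁻¹ - ((m : ℝ) - n + 1) * τ|} := by
    have h1 : Measurable fun x : Fin m × Fin n → ℂ => ((entryGram x)⁻¹ k k).re :=
      Complex.measurable_re.comp (measurable_entryGram_inv k k)
    have h2 : MeasurableSet {x : Fin m × Fin n → ℂ |
        δ ≤ |(((entryGram x)⁻¹ k k).re)⁻¹ - ((m : ℝ) - n + 1) * τ|} :=
      measurableSet_le measurable_const (h1.inv.sub_const _).abs
    exact (measurable_det_entryGram (measurableSet_singleton 0).compl).inter h2
  refine channel_measure_le hH ht hC hmeas fun o => ?_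
  obtain ⟨hE, -⟩ := innovation_law hH ht hC
  set V := Submodule.span ℂ (Set.range fun j : {j // j ≠ k} =>
    (WithLp.toLp 2 fun i => o (i, j) : EuclideanSpace ℂ (Fin m))) with hV
  -- If the frozen columns are dependent, the dimension is wrong, but then the Gram matrix is
  -- singular for every innovation and the event is empty.
  by_cases hfr : (Module.finrank ℂ Vᗮ : ℝ) = m - n + 1
  · refine (measure_mono fun ω hω => ?_).trans
      ((hE.projection_concentration Vᗮ hδ).trans_eq (by rw [hfr]))
    obtain ⟨h1, h2⟩ := hω
    have h3 := (gram_inv_diag h1 k).2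
    rw [← starProjection_orthogonal_mulVec _ ht, rebuild_mulVec ht, otherColSpan_rebuild,
      ← hV] at h3
    rw [Set.mem_ofPred_eq, hfr, h3]
    exact h2
  · refine (measure_mono (t := ∅) fun ω hω => ?_).trans (by simp)
    have := finrank_otherColSpan_orthogonal hω.1 k
    rw [otherColSpan_rebuild, ← hV] at this
    exact hfr this

end channel

/-! ### Decision regions and the negligibility of ties -/

section decision

/-- The noise values for which a symbol `a` has a nearest neighbour in `S` at `a` itself. -/
def decisionRegion (S : Set ℂ) (a : ℂ) : Set ℂ := {z | ∀ b ∈ S, ‖z‖ ≤ ‖z + a - b‖}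

/-- The noise values for which `a` is the only nearest point. -/
def strictDecisionRegion (S : Set ℂ) (a : ℂ) : Set ℂ := {z | ∀ b ∈ S, b ≠ a → ‖z‖ < ‖z + a - b‖}

theorem measurableSet_decisionRegion {S : Set ℂ} (hS : S.Finite) (a : ℂ) :
    MeasurableSet (decisionRegion S a) := by
  have : decisionRegion S a = ⋂ b ∈ S, {z | ‖z‖ ≤ ‖z + a - b‖} := by
    ext z; simp [decisionRegion]
  rw [this]
  exact MeasurableSet.biInter hS.countable fun b _ => measurableSet_le (by fun_prop) (by fun_prop)

theorem measurableSet_strictDecisionRegion {S : Set ℂ} (hS : S.Finite) (a : ℂ) :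
    MeasurableSet (strictDecisionRegion S a) := by
  have : strictDecisionRegion S a = ⋂ b ∈ S \ {a}, {z | ‖z‖ < ‖z + a - b‖} := by
    ext z; simp [strictDecisionRegion]
  rw [this]
  exact MeasurableSet.biInter hS.sdiff.countable fun b _ =>
    measurableSet_lt (by fun_prop) (by fun_prop)

theorem measurable_cGauss_apply {W : Set ℂ} (hW : MeasurableSet W) :
    Measurable fun v : ℝ≥0 => cGauss v W := by
  let κ : Kernel ℝ≥0 ℝ := ⟨fun v => gaussianReal 0 (v / 2),
    measurable_gaussianReal.comp (measurable_const.prodMk (measurable_id.div_const 2))⟩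
  have : IsMarkovKernel κ := ⟨fun v => by
    change IsProbabilityMeasure (gaussianReal 0 (v / 2)); infer_instance⟩
  have h : (fun v : ℝ≥0 => cGauss v W) =
      fun v => (κ ×ₖ κ) v (Complex.measurableEquivRealProd.symm ⁻¹' W) := by
    funext v
    rw [cGauss, MeasurableEquiv.map_apply, Kernel.prod_apply]
    rfl
  rw [h]
  exact Kernel.measurable_coe _ (Complex.measurableEquivRealProd.symm.measurable hW)

theorem cGauss_absolutelyContinuous {v : ℝ≥0} (hv : v ≠ 0) : cGauss v ≪ volume := by
  have h := gaussianReal_absolutelyContinuous 0 (v := v / 2) (div_ne_zero hv two_ne_zero)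
  have h2 := (h.prod h).map Complex.measurableEquivRealProd.symm.measurable
  have h3 := Complex.volume_preserving_equiv_real_prod.symm.map_eq
  rw [← Measure.volume_eq_prod, h3] at h2
  exact h2

/-- The tie set is a perpendicular bisector, a proper affine subspace, hence Lebesgue null. -/
theorem cGauss_bisector {v : ℝ≥0} (hv : v ≠ 0) {d : ℂ} (hd : d ≠ 0) :
    cGauss v {z | ‖z‖ = ‖z + d‖} = 0 := by
  apply cGauss_absolutelyContinuous hv
  have : {z : ℂ | ‖z‖ = ‖z + d‖} = AffineSubspace.perpBisector (0 : ℂ) (-d) := by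
    ext z
    simp [AffineSubspace.mem_perpBisector_iff_dist_eq, dist_eq_norm]
  rw [this]
  refine Measure.addHaar_affineSubspace _ _ ?_
  rw [Ne, AffineSubspace.perpBisector_eq_top, eq_comm, neg_eq_zero]
  exact hd

theorem cGauss_strictDecisionRegion {S : Set ℂ} (hS : S.Finite) {a : ℂ} {v : ℝ≥0}
    (hv : v ≠ 0) :
    cGauss v (strictDecisionRegion S a)ᶜ = cGauss v (decisionRegion S a)ᶜ := by
  refine le_antisymm ?_ (measure_mono (Set.compl_subset_compl.2 fun z hz b hb => ?_))
  · have hsub : (strictDecisionRegion S a)ᶜ ⊆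
        (decisionRegion S a)ᶜ ∪ ⋃ b ∈ S \ {a}, {z | ‖z‖ = ‖z + (a - b)‖} := by
      intro z hz
      by_contra hcon
      simp only [Set.mem_union, Set.mem_compl_iff, not_or, not_not, Set.mem_iUnion,
        Set.mem_ofPred_eq, not_exists] at hcon
      refine hz fun b hb hba => lt_of_le_of_ne (hcon.1 b hb) ?_
      rw [add_sub_assoc]
      exact hcon.2 b ⟨hb, hba⟩
    refine (measure_mono hsub).trans ((measure_union_le _ _).trans_eq ?_)
    have hnull : cGauss v (⋃ b ∈ S \ {a}, {z | ‖z‖ = ‖z + (a - b)‖}) = 0 :=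
      (measure_biUnion_null_iff hS.sdiff.countable).2 fun b hb =>
        cGauss_bisector hv (sub_ne_zero.2 (Ne.symm hb.2))
    rw [hnull, add_zero]
  · by_cases hba : b = a
    · subst hba; simp
    · exact (hz b hb hba).le

end decision

/-! ### Zero forcing: conditional noise law and exact symbol error -/

section zf

variable {m n : ℕ}

theorem mul_uniformPrecoder (A : Matrix (Fin m) (Fin n) ℂ) :
    A * uniformPrecoder n = ((1 / Real.sqrt (n : ℝ) : ℝ) : ℂ) • A := by
  rw [uniformPrecoder, Matrix.mul_smul, Matrix.mul_one]

theorem gram_mul_uniformPrecoder (A : Matrix (Fin m) (Fin n) ℂ) :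
    (A * uniformPrecoder n).conjTranspose * (A * uniformPrecoder n) =
      ((1 / (n : ℝ) : ℝ) : ℂ) • (A.conjTranspose * A) := by
  rw [mul_uniformPrecoder, Matrix.conjTranspose_smul, Matrix.smul_mul, Matrix.mul_smul, smul_smul]
  congr 1
  rw [Complex.star_def, Complex.conj_ofReal, ← Complex.ofReal_mul, div_mul_div_comm,
    Real.mul_self_sqrt (Nat.cast_nonneg n), one_mul]

theorem gram_precoded_det_ne_zero {A : Matrix (Fin m) (Fin n) ℂ} (hn : 0 < n)
    (hA : (A.conjTranspose * A).det ≠ 0) :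
    ((A * uniformPrecoder n).conjTranspose * (A * uniformPrecoder n)).det ≠ 0 := by
  rw [gram_mul_uniformPrecoder, Matrix.det_smul]
  refine mul_ne_zero (pow_ne_zero _ ?_) hA
  have : (0 : ℝ) < 1 / n := by positivity
  exact_mod_cast this.ne'

theorem pseudoInverse_mulVec {A : Matrix (Fin m) (Fin n) ℂ}
    (hA : (A.conjTranspose * A).det ≠ 0) (x : Fin n → ℂ) (w : Fin m → ℂ) :
    (pseudoInverse A).mulVec (A.mulVec x + w) = x + (pseudoInverse A).mulVec w := by
  rw [Matrix.mulVec_add, Matrix.mulVec_mulVec, pseudoInverse, Matrix.mul_assoc,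
    Matrix.nonsing_inv_mul _ (isUnit_iff_ne_zero.2 hA), Matrix.one_mulVec]

/-- With `P` the pseudo-inverse, the left side is the conjugate of `P Pᴴ = (AᴴA)⁻¹`; on the diagonal
the conjugate is harmless, the entries being real. -/
theorem pseudoInverse_covariance {A : Matrix (Fin m) (Fin n) ℂ}
    (hA : (A.conjTranspose * A).det ≠ 0) (k : Fin n) :
    ((pseudoInverse A).map conj * (pseudoInverse A).transpose) k k =
      (A.conjTranspose * A)⁻¹ k k := by
  have h1 : pseudoInverse A * (pseudoInverse A).conjTranspose = (A.conjTranspose * A)⁻¹ := by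
    rw [pseudoInverse, Matrix.conjTranspose_mul, Matrix.conjTranspose_conjTranspose,
      Matrix.conjTranspose_nonsing_inv, Matrix.conjTranspose_mul,
      Matrix.conjTranspose_conjTranspose, Matrix.mul_assoc, ← Matrix.mul_assoc _ A,
      Matrix.mul_nonsing_inv _ (isUnit_iff_ne_zero.2 hA), Matrix.mul_one]
  have h2 := gram_inv_diag hA k
  rw [← h1] at h2 ⊢
  have h3 : ((pseudoInverse A).map conj * (pseudoInverse A).transpose) k k =
      conj ((pseudoInverse A * (pseudoInverse A).conjTranspose) k k) := by
    simp [Matrix.mul_apply]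
  rw [h3, Complex.conj_eq_iff_im]
  exact h2.1.1

/-- The variance of the equalized noise of the `k`-th symbol. -/
def noiseVar (σ : ℝ) (A : Matrix (Fin m) (Fin n) ℂ) (k : Fin n) : ℝ :=
  σ ^ 2 * n * ((A.conjTranspose * A)⁻¹ k k).re

theorem noiseVar_pos {σ : ℝ} (hσ : 0 < σ) {A : Matrix (Fin m) (Fin n) ℂ}
    (hA : (A.conjTranspose * A).det ≠ 0) (k : Fin n) : 0 < noiseVar σ A k := by
  have := (gram_inv_diag hA k).1.2
  have hn : 0 < n := k.pos
  unfold noiseVar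
  positivity

theorem equalized_noise_law {Ω : Type*} [MeasurableSpace Ω] {μ : Measure Ω} {σ : ℝ}
    {ξ : Ω → Fin m → ℂ}
    (hξ : IsCircularGaussian ξ (((σ ^ 2 : ℝ) : ℂ) • (1 : Matrix (Fin m) (Fin m) ℂ)) μ)
    {A : Matrix (Fin m) (Fin n) ℂ} (hA : (A.conjTranspose * A).det ≠ 0) (k : Fin n) :
    μ.map (fun ω => (pseudoInverse (A * uniformPrecoder n)).mulVec (ξ ω) k) =
      cGauss (noiseVar σ A k).toNNReal := by
  have hn : 0 < n := k.pos
  have hA' := gram_precoded_det_ne_zero hn hA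
  set P := pseudoInverse (A * uniformPrecoder n) with hP
  have h1 := hξ.mulVec P
  have h2 : (P.map conj * ((σ ^ 2 : ℝ) : ℂ) • (1 : Matrix (Fin m) (Fin m) ℂ) * P.transpose) k k =
      (noiseVar σ A k : ℂ) := by
    rw [Matrix.mul_smul, Matrix.mul_one, Matrix.smul_mul, Matrix.smul_apply, hP,
      pseudoInverse_covariance hA', gram_mul_uniformPrecoder]
    have hu : IsUnit (((1 / (n : ℝ) : ℝ) : ℂ)) := by
      rw [isUnit_iff_ne_zero]
      have : (0 : ℝ) < 1 / n := by positivity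
      exact_mod_cast this.ne'
    have h3 : ((((1 / (n : ℝ) : ℝ) : ℂ)) • (A.conjTranspose * A))⁻¹ =
        ((n : ℝ) : ℂ) • (A.conjTranspose * A)⁻¹ := by
      refine Matrix.inv_eq_left_inv ?_
      rw [Matrix.smul_mul, Matrix.mul_smul, smul_smul,
        Matrix.nonsing_inv_mul _ (isUnit_iff_ne_zero.2 hA), ← Complex.ofReal_mul,
        mul_one_div_cancel (by positivity), Complex.ofReal_one, one_smul]
    rw [h3, Matrix.smul_apply, smul_eq_mul, smul_eq_mul]
    apply Complex.ext
    · simp only [noiseVar, Complex.re_ofReal_mul, Complex.ofReal_re]; ring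
    · simp [-Complex.ofReal_pow, -Complex.ofReal_natCast,
        (gram_inv_diag hA k).1.1]
  have h4 := h1.map_eval k (by rw [h2, Complex.ofReal_im])
  rwa [h2, Complex.ofReal_re] at h4

theorem measurable_equalized_noise (k : Fin n) :
    Measurable fun q : (Fin m × Fin n → ℂ) × (Fin m → ℂ) =>
      (pseudoInverse (entryMatrix q.1 * uniformPrecoder n)).mulVec q.2 k := by
  have hP (i : Fin m) : Measurable fun x : Fin m × Fin n → ℂ =>
      pseudoInverse (entryMatrix x * uniformPrecoder n) k i := by
    set c : ℂ := ((1 / Real.sqrt (n : ℝ) : ℝ) : ℂ) with hc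
    -- The precoder is a scalar, so it can be absorbed into the entries, and the measurability of
    -- the inverse Gram matrix applies at `c • x`.
    have h1 (x : Fin m × Fin n → ℂ) :
        pseudoInverse (entryMatrix x * uniformPrecoder n) k i =
          ∑ j, (entryGram (c • x))⁻¹ k j * conj ((c • x) (i, j)) := by
      rw [mul_uniformPrecoder, ← hc]
      rfl
    simp only [h1]
    refine Finset.measurable_sum _ fun j _ => ?_
    have hs : Measurable fun x : Fin m × Fin n → ℂ => c • x := measurable_const_smul c
    refine ((measurable_entryGram_inv k j).comp hs).mul ?_
    exact Complex.continuous_conj.measurable.comp ((measurable_pi_apply (i, j)).comp hs)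
  simp only [Matrix.mulVec, dotProduct]
  exact Finset.measurable_sum _ fun i _ =>
    ((hP i).comp measurable_fst).mul ((measurable_pi_apply i).comp measurable_snd)

theorem measurable_noiseVar (σ : ℝ) (k : Fin n) :
    Measurable fun x : Fin m × Fin n → ℂ => noiseVar σ (entryMatrix x) k :=
  (Complex.measurable_re.comp (measurable_entryGram_inv k k)).const_mul _

variable {Ω : Type*} [MeasurableSpace Ω] {μ : Measure Ω} [IsProbabilityMeasure μ]
  {S : Set ℂ} {C : Matrix (Fin n) (Fin n) ℂ} {σ : ℝ} {H : Ω → Matrix (Fin m) (Fin n) ℂ}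
  {s sHat : Ω → Fin n → ℂ} {ξ : Ω → Fin m → ℂ}

/-- Independence of the channel allows integrating over it last; for a fixed full-rank channel, the
symbol and the equalized noise are independent and the latter has a known law. -/
theorem measure_symbol_and_noise
    (hl : IsZFLink μ S C (uniformPrecoder n) σ H s ξ sHat) (k : Fin n) (a : ℂ) {W : Set ℂ}
    (hW : MeasurableSet W) :
    μ {ω | ((H ω).conjTranspose * H ω).det ≠ 0 ∧ s ω k = a ∧
        (pseudoInverse (H ω * uniformPrecoder n)).mulVec (ξ ω) k ∈ W} =
      ∫⁻ x in {x | (entryGram x).det ≠ 0},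
        μ {ω | s ω k = a} * cGauss (noiseVar σ (entryMatrix x) k).toNNReal W
        ∂(μ.map fun ω (p : Fin m × Fin n) => H ω p.1 p.2) := by
  have hHm : AEMeasurable (fun ω (p : Fin m × Fin n) => H ω p.1 p.2) μ := hl.channel.aemeasurable
  have hsm := hl.symbols_measurable
  have hξm := hl.noise.aemeasurable
  have hsξ : AEMeasurable (fun ω => (s ω, ξ ω)) μ := hsm.aemeasurable.prodMk hξm
  have hD : MeasurableSet {x : Fin m × Fin n → ℂ | (entryGram x).det ≠ 0} :=
    measurable_det_entryGram (measurableSet_singleton 0).compl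
  let T₁ : Set ((Fin m × Fin n → ℂ) × (Fin n → ℂ) × (Fin m → ℂ)) :=
    {q | (entryGram q.1).det ≠ 0}
  let T₂ : Set ((Fin m × Fin n → ℂ) × (Fin n → ℂ) × (Fin m → ℂ)) := {q | q.2.1 k = a}
  let T₃ : Set ((Fin m × Fin n → ℂ) × (Fin n → ℂ) × (Fin m → ℂ)) :=
    {q | (pseudoInverse (entryMatrix q.1 * uniformPrecoder n)).mulVec q.2.2 k ∈ W}
  let T := T₁ ∩ (T₂ ∩ T₃)
  have hT : MeasurableSet T := by
    have h0 : Measurable fun q : (Fin m × Fin n → ℂ) × (Fin n → ℂ) × (Fin m → ℂ) =>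
        (q.1, q.2.2) := by fun_prop
    have h1 := (measurable_equalized_noise (m := m) k).comp h0
    have h2 : Measurable fun q : (Fin m × Fin n → ℂ) × (Fin n → ℂ) × (Fin m → ℂ) => q.2.1 k := by
      fun_prop
    have h3 : MeasurableSet T₁ := measurable_fst hD
    have h4 : MeasurableSet T₂ := h2 (measurableSet_singleton a)
    have h5 : MeasurableSet T₃ := h1 hW
    exact h3.inter (h4.inter h5)
  have hprod := (indepFun_iff_map_prod_eq_prod_map_map hHm hsξ).1 hl.indep_channel
  have : IsProbabilityMeasure (μ.map fun ω => (s ω, ξ ω)) := Measure.isProbabilityMeasure_map hsξ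
  have h1 : μ {ω | ((H ω).conjTranspose * H ω).det ≠ 0 ∧ s ω k = a ∧
        (pseudoInverse (H ω * uniformPrecoder n)).mulVec (ξ ω) k ∈ W} =
      μ.map (fun ω => ((fun p : Fin m × Fin n => H ω p.1 p.2), (s ω, ξ ω))) T := by
    rw [Measure.map_apply_of_aemeasurable (hHm.prodMk hsξ) hT]
    rfl
  rw [h1, hprod, Measure.prod_apply hT, ← lintegral_indicator hD]
  refine lintegral_congr fun x => ?_
  rw [Measure.map_apply_of_aemeasurable hsξ (measurable_prodMk_left hT)]
  by_cases hx : (entryGram x).det ≠ 0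
  · rw [Set.indicator_of_mem (by exact hx)]
    have h0 : Measurable fun w : Fin m → ℂ => (x, w) := by fun_prop
    have hN : Measurable fun w : Fin m → ℂ =>
        (pseudoInverse (entryMatrix x * uniformPrecoder n)).mulVec w k := by
      have h1 := (measurable_equalized_noise (m := m) k).comp h0
      simpa only [Function.comp_def] using h1
    have hlaw := equalized_noise_law hl.noise (A := entryMatrix x) hx k
    have h3 : cGauss (noiseVar σ (entryMatrix x) k).toNNReal W =
        μ (ξ ⁻¹'
          ((fun w => (pseudoInverse (entryMatrix x * uniformPrecoder n)).mulVec w k) ⁻¹' W)) := by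
      rw [← hlaw]
      exact Measure.map_apply_of_aemeasurable (hN.comp_aemeasurable hξm) hW
    rw [h3]
    have h2 := hl.indep_symbols_noise.measure_inter_preimage_eq_mul
      ((fun u : Fin n → ℂ => u k) ⁻¹' {a})
      ((fun w => (pseudoInverse (entryMatrix x * uniformPrecoder n)).mulVec w k) ⁻¹' W)
      ((measurable_pi_apply k) (measurableSet_singleton a)) (hN hW)
    refine Eq.trans (congrArg μ ?_) h2
    ext ω
    exact ⟨fun h => h.2, fun h => ⟨hx, h⟩⟩
  · rw [Set.indicator_of_notMem (by exact hx)]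
    refine measure_mono_null (t := ∅) (fun ω hω => hx hω.1) measure_empty

theorem measure_symbol_eq (hl : IsZFLink μ S C (uniformPrecoder n) σ H s ξ sHat)
    (k : Fin n) {a : ℂ} (ha : a ∈ S) :
    μ {ω | s ω k = a} = ENNReal.ofReal (1 / (S.ncard : ℝ)) := by
  rw [← hl.symbols_uniform k a ha, ofReal_measureReal]

/-- The masses prescribed at the points of `S` already add up to one. -/
theorem measure_symbol_notMem (hl : IsZFLink μ S C (uniformPrecoder n) σ H s ξ sHat)
    (hS : S.Finite) (hne : S.Nonempty) (k : Fin n) : μ {ω | s ω k ∉ S} = 0 := by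
  have hk : Measurable fun ω => s ω k := (measurable_pi_apply k).comp hl.symbols_measurable
  have h1 : μ {ω | s ω k ∈ S} = 1 := by
    have : {ω | s ω k ∈ S} = ⋃ a ∈ hS.toFinset, {ω | s ω k = a} := by
      ext ω; simp
    rw [this, measure_biUnion_finset]
    · rw [Finset.sum_congr rfl fun a ha => measure_symbol_eq hl k (hS.mem_toFinset.1 ha),
        Finset.sum_const, ← Set.ncard_eq_toFinset_card S hS, nsmul_eq_mul,
        ← ENNReal.ofReal_natCast, ← ENNReal.ofReal_mul (by positivity),
        mul_one_div_cancel, ENNReal.ofReal_one]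
      exact_mod_cast ((Set.ncard_pos hS).2 hne).ne'
    · intro a _ b _ hab
      refine Set.disjoint_left.2 fun ω h1 h2 => hab ?_
      exact (h1 : s ω k = a).symm.trans h2
    · exact fun a _ => hk (measurableSet_singleton a)
  exact (prob_compl_eq_zero_iff (hk hS.measurableSet)).2 h1

/-- The error event is squeezed, up to null sets, between "some point is strictly closer than the
sent one" and "the sent point is not the unique nearest". These have equal probability because ties
are null, so neither the tie-breaking rule nor measurability of `sHat` plays a role. -/
theorem symbolError_eq (hl : IsZFLink μ S C (uniformPrecoder n) σ H s ξ sHat) (hσ : 0 < σ)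
    (hS : S.Finite) (hne : S.Nonempty) (hdet : μ {ω | ((H ω).conjTranspose * H ω).det = 0} = 0)
    {f : ℝ → ℝ} (hf : ∀ v : ℝ≥0, v ≠ 0 →
      ∑ a ∈ hS.toFinset, (cGauss v).real (decisionRegion S a)ᶜ = S.ncard * f (1 / v))
    (k : Fin n) :
    μ {ω | sHat ω k ≠ s ω k} =
      ∫⁻ x in {x | (entryGram x).det ≠ 0},
        ENNReal.ofReal (f (1 / noiseVar σ (entryMatrix x) k))
        ∂(μ.map fun ω (p : Fin m × Fin n) => H ω p.1 p.2) := by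
  set ν := μ.map fun ω (p : Fin m × Fin n) => H ω p.1 p.2
  have hD : MeasurableSet {x : Fin m × Fin n → ℂ | (entryGram x).det ≠ 0} :=
    measurable_det_entryGram (measurableSet_singleton 0).compl
  have hcard : (0 : ℝ) < S.ncard := by exact_mod_cast (Set.ncard_pos hS).2 hne
  let E (R : ℂ → Set ℂ) (a : ℂ) : Set Ω :=
    {ω | ((H ω).conjTranspose * H ω).det ≠ 0 ∧ s ω k = a ∧
      (pseudoInverse (H ω * uniformPrecoder n)).mulVec (ξ ω) k ∈ (R a)ᶜ}
  have hEm (R : ℂ → Set ℂ) (hR : ∀ a, MeasurableSet (R a)) (a : ℂ) :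
      NullMeasurableSet (E R a) μ := by
    have hHm : AEMeasurable (fun ω (p : Fin m × Fin n) => H ω p.1 p.2) μ :=
      hl.channel.aemeasurable
    have hξm := hl.noise.aemeasurable
    have hk : Measurable fun ω => s ω k := (measurable_pi_apply k).comp hl.symbols_measurable
    have h1 := (measurable_equalized_noise (m := m) k).comp_aemeasurable (hHm.prodMk hξm)
    have h2 : NullMeasurableSet {ω | ((H ω).conjTranspose * H ω).det ≠ 0} μ :=
      hHm.nullMeasurableSet_preimage hD
    have h3 : NullMeasurableSet {ω | s ω k = a} μ :=
      (hk (measurableSet_singleton a)).nullMeasurableSet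
    have h4 : NullMeasurableSet {ω | (pseudoInverse (H ω * uniformPrecoder n)).mulVec (ξ ω) k ∈
        (R a)ᶜ} μ := h1.nullMeasurableSet_preimage (hR a).compl
    have h5 := h2.inter (h3.inter h4)
    exact h5
  have hsum (R : ℂ → Set ℂ) (hR : ∀ a, MeasurableSet (R a)) :
      (∀ v : ℝ≥0, v ≠ 0 → ∀ a, cGauss v (R a)ᶜ = cGauss v (decisionRegion S a)ᶜ) →
      μ (⋃ a ∈ hS.toFinset, E R a) = ∫⁻ x in {x | (entryGram x).det ≠ 0},
        ENNReal.ofReal (f (1 / noiseVar σ (entryMatrix x) k)) ∂ν := by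
    intro hRv
    rw [measure_biUnion_finset₀ (fun a _ b _ hab => ?_) fun a _ => hEm R hR a]
    · have h1 (a : ℂ) (ha : a ∈ hS.toFinset) : μ (E R a) =
          ∫⁻ x in {x | (entryGram x).det ≠ 0}, ENNReal.ofReal (1 / (S.ncard : ℝ) *
            (cGauss (noiseVar σ (entryMatrix x) k).toNNReal).real (decisionRegion S a)ᶜ) ∂ν := by
        rw [measure_symbol_and_noise hl k a (hR a).compl,
          measure_symbol_eq hl k (hS.mem_toFinset.1 ha)]
        refine setLIntegral_congr_fun hD fun x hx => ?_
        have hv := noiseVar_pos hσ hx k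
        rw [ENNReal.ofReal_mul (by positivity), ofReal_measureReal,
          hRv _ (by simpa using hv)]
      rw [Finset.sum_congr rfl h1]
      have h2 (a : ℂ) : AEMeasurable (fun x => ENNReal.ofReal (1 / (S.ncard : ℝ) *
            (cGauss (noiseVar σ (entryMatrix x) k).toNNReal).real (decisionRegion S a)ᶜ))
            (ν.restrict {x : Fin m × Fin n → ℂ | (entryGram x).det ≠ 0}) := by
        have h3 := (measurable_cGauss_apply (measurableSet_decisionRegion hS a).compl).comp
          (measurable_noiseVar (m := m) σ k).real_toNNReal
        exact (h3.ennreal_toReal.const_mul _).ennreal_ofReal.aemeasurable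
      rw [← lintegral_finsetSum' _ fun a _ => h2 a]
      refine setLIntegral_congr_fun hD fun x hx => ?_
      have hv := noiseVar_pos hσ hx k
      rw [← ENNReal.ofReal_sum_of_nonneg fun a _ => by positivity, ← Finset.mul_sum,
        hf _ (by simpa using hv), Real.coe_toNNReal _ hv.le]
      congr 1
      field_simp
    · refine (Set.disjoint_left.2 fun ω h1 h2 => hab ?_).aedisjoint
      exact h1.2.1.symm.trans h2.2.1
  have hy (ω : Ω) (hω : ((H ω).conjTranspose * H ω).det ≠ 0) (b : ℂ) :
      (pseudoInverse (H ω * uniformPrecoder n)).mulVec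
        ((H ω * uniformPrecoder n).mulVec (s ω) + ξ ω) k - b =
      (pseudoInverse (H ω * uniformPrecoder n)).mulVec (ξ ω) k + s ω k - b := by
    rw [pseudoInverse_mulVec (gram_precoded_det_ne_zero k.pos hω), Pi.add_apply, add_comm (s ω k)]
  apply le_antisymm
  · rw [← hsum (strictDecisionRegion S) (measurableSet_strictDecisionRegion hS)
      fun v hv a => cGauss_strictDecisionRegion hS hv]
    have hsub : {ω | sHat ω k ≠ s ω k} ⊆ {ω | ((H ω).conjTranspose * H ω).det = 0} ∪
        {ω | s ω k ∉ S} ∪ ⋃ a ∈ hS.toFinset, E (strictDecisionRegion S) a := by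
      intro ω hω
      by_contra hcon
      simp only [Set.mem_union, not_or, Set.mem_ofPred_eq, not_not, Set.mem_iUnion, not_exists,
        Set.Finite.mem_toFinset] at hcon
      obtain ⟨⟨hd, hs⟩, hE⟩ := hcon
      have h1 := hE (s ω k) hs
      simp only [E, Set.mem_ofPred_eq, not_and, Set.mem_compl_iff, not_not] at h1
      have h2 := h1 hd trivial (sHat ω k) (hl.detector_mem ω k) hω
      have h3 := hl.detector_nearest ω k (s ω k) hs
      rw [hy ω hd, hy ω hd, add_sub_cancel_right] at h3
      exact absurd h2 (not_lt.2 h3)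
    refine (measure_mono hsub).trans ((measure_union_le _ _).trans_eq ?_)
    rw [measure_union_null hdet (measure_symbol_notMem hl hS hne k), zero_add]
  · rw [← hsum (decisionRegion S) (measurableSet_decisionRegion hS) fun _ _ _ => rfl]
    refine measure_mono fun ω hω => ?_
    simp only [Set.mem_iUnion, E, Set.mem_ofPred_eq] at hω
    obtain ⟨a, ha, hd, rfl, hN⟩ := hω
    intro heq
    refine hN fun b hb => ?_
    have h3 := hl.detector_nearest ω k b hb
    rwa [hy ω hd, hy ω hd, heq, add_sub_cancel_right] at h3

end zf

/-! ### From concentration to the limit of the average error -/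

section limit

theorem errorRate_mem_Icc {S : Set ℂ} (hS : S.Finite) (hne : S.Nonempty) {f : ℝ → ℝ}
    (hf : ∀ v : ℝ≥0, v ≠ 0 →
      ∑ a ∈ hS.toFinset, (cGauss v).real (decisionRegion S a)ᶜ = S.ncard * f (1 / v))
    {y : ℝ} (hy : 0 < y) : 0 ≤ f y ∧ f y ≤ 1 := by
  have hcard : (0 : ℝ) < S.ncard := by exact_mod_cast (Set.ncard_pos hS).2 hne
  have h1 := hf (1 / y).toNNReal (by simpa using hy)
  rw [Real.coe_toNNReal _ (by positivity), one_div_one_div] at h1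
  constructor
  · have : 0 ≤ S.ncard * f y := by rw [← h1]; positivity
    exact nonneg_of_mul_nonneg_right this hcard
  · have : S.ncard * f y ≤ S.ncard * 1 := by
      rw [← h1, mul_one, Set.ncard_eq_toFinset_card S hS]
      exact (Finset.sum_le_card_nsmul _ _ 1 fun a _ => measureReal_le_one).trans (by simp)
    exact le_of_mul_le_mul_left this hcard

/-- One `ε` pays for the oscillation of `f` near `x₀`, the other for the bad event, on which `f` and
`f x₀` both lie in `[0,1]`. -/
theorem symbolError_bound {m n : ℕ} {Ω : Type*} [MeasurableSpace Ω] {μ : Measure Ω}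
    [IsProbabilityMeasure μ] {S : Set ℂ} {C : Matrix (Fin n) (Fin n) ℂ} {σ : ℝ}
    {H : Ω → Matrix (Fin m) (Fin n) ℂ} {s sHat : Ω → Fin n → ℂ} {ξ : Ω → Fin m → ℂ}
    (hl : IsZFLink μ S C (uniformPrecoder n) σ H s ξ sHat) (hσ : 0 < σ)
    (hS : S.Finite) (hne : S.Nonempty) (hdet : μ {ω | ((H ω).conjTranspose * H ω).det = 0} = 0)
    {f : ℝ → ℝ} (hf : ∀ v : ℝ≥0, v ≠ 0 →
      ∑ a ∈ hS.toFinset, (cGauss v).real (decisionRegion S a)ᶜ = S.ncard * f (1 / v))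
    (k : Fin n) {x₀ ε δ : ℝ} (hx₀ : 0 < x₀) (hε : 0 ≤ ε)
    (hclose : ∀ y, |y - x₀| < δ → |f y - f x₀| ≤ ε)
    (hbad : μ {ω | ((H ω).conjTranspose * H ω).det ≠ 0 ∧ δ ≤ |1 / noiseVar σ (H ω) k - x₀|} ≤
      ENNReal.ofReal ε) :
    |μ.real {ω | sHat ω k ≠ s ω k} - f x₀| ≤ 2 * ε := by
  have hf01 (y : ℝ) (hy : 0 < y) := errorRate_mem_Icc hS hne hf hy
  have herr := symbolError_eq hl hσ hS hne hdet hf k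
  have hHm : AEMeasurable (fun ω (p : Fin m × Fin n) => H ω p.1 p.2) μ := hl.channel.aemeasurable
  set ν := μ.map fun ω (p : Fin m × Fin n) => H ω p.1 p.2 with hν
  have hνp : IsProbabilityMeasure ν := Measure.isProbabilityMeasure_map hHm
  set D : Set (Fin m × Fin n → ℂ) := {x | (entryGram x).det ≠ 0} with hDdef
  have hD : MeasurableSet D := measurable_det_entryGram (measurableSet_singleton 0).compl
  have hνD : ν D = 1 := by
    rw [← prob_compl_eq_zero_iff hD, Measure.map_apply_of_aemeasurable hHm hD.compl]
    refine measure_mono_null (fun ω hω => ?_) hdet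
    exact not_not.1 hω
  set g : (Fin m × Fin n → ℂ) → ℝ := fun x => 1 / noiseVar σ (entryMatrix x) k with hg
  have hgm : Measurable g := (measurable_noiseVar σ k).const_div 1
  let B₀ : Set (Fin m × Fin n → ℂ) := {x | δ ≤ |g x - x₀|}
  let B : Set (Fin m × Fin n → ℂ) := D ∩ B₀
  have hB₀ : MeasurableSet B₀ := measurableSet_le measurable_const (hgm.sub_const _).abs
  have hBm : MeasurableSet B := hD.inter hB₀
  have hνB : ν B ≤ ENNReal.ofReal ε := by
    rw [Measure.map_apply_of_aemeasurable hHm hBm]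
    exact hbad
  have hgpos (x) (hx : x ∈ D) : 0 < g x := one_div_pos.2 (noiseVar_pos hσ hx k)
  have hind : ∫⁻ x in D, B.indicator 1 x ∂ν ≤ ENNReal.ofReal ε := by
    refine (setLIntegral_le_lintegral D _).trans ?_
    rwa [lintegral_indicator_one hBm]
  have hBi : Measurable (B.indicator (1 : (Fin m × Fin n → ℂ) → ℝ≥0∞)) :=
    measurable_one.indicator hBm
  have hcl (x) (hx : x ∈ D) (hxB : x ∉ B) : |f (g x) - f x₀| ≤ ε := by
    refine hclose _ (not_le.1 fun h => hxB ⟨hx, h⟩)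
  have hx01 := hf01 x₀ hx₀
  have hupper : μ {ω | sHat ω k ≠ s ω k} ≤ ENNReal.ofReal (f x₀ + 2 * ε) := by
    calc μ {ω | sHat ω k ≠ s ω k} = ∫⁻ x in D, ENNReal.ofReal (f (g x)) ∂ν := herr
      _ ≤ ∫⁻ x in D, (ENNReal.ofReal (f x₀ + ε) + B.indicator 1 x) ∂ν := by
        refine setLIntegral_mono' hD fun x hx => ?_
        by_cases hxB : x ∈ B
        · rw [Set.indicator_of_mem hxB]
          exact (ENNReal.ofReal_le_one.2 (hf01 _ (hgpos x hx)).2).trans le_add_self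
        · refine le_add_right (ENNReal.ofReal_le_ofReal ?_)
          have := (abs_le.1 (hcl x hx hxB)).2
          linarith
      _ = ENNReal.ofReal (f x₀ + ε) + ∫⁻ x in D, B.indicator 1 x ∂ν := by
        rw [lintegral_add_right _ hBi, setLIntegral_const, hνD, mul_one]
      _ ≤ ENNReal.ofReal (f x₀ + ε) + ENNReal.ofReal ε := by gcongr
      _ = ENNReal.ofReal (f x₀ + 2 * ε) := by
        rw [← ENNReal.ofReal_add (by linarith [hx01.1]) hε]; congr 1; ring
  -- The lower bound is kept additive to avoid truncated subtraction in `ℝ≥0∞`.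
  have hlower : ENNReal.ofReal (f x₀) ≤ μ {ω | sHat ω k ≠ s ω k} + ENNReal.ofReal (2 * ε) := by
    calc ENNReal.ofReal (f x₀) = ∫⁻ x in D, ENNReal.ofReal (f x₀) ∂ν := by
          rw [setLIntegral_const, hνD, mul_one]
      _ ≤ ∫⁻ x in D, (ENNReal.ofReal (f (g x)) + (ENNReal.ofReal ε + B.indicator 1 x)) ∂ν := by
        refine setLIntegral_mono' hD fun x hx => ?_
        by_cases hxB : x ∈ B
        · rw [Set.indicator_of_mem hxB]
          exact (ENNReal.ofReal_le_one.2 hx01.2).trans (le_add_left le_add_self)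
        · rw [← add_assoc, ← ENNReal.ofReal_add (hf01 _ (hgpos x hx)).1 hε]
          refine le_add_right (ENNReal.ofReal_le_ofReal ?_)
          have := (abs_le.1 (hcl x hx hxB)).1
          linarith
      _ = (∫⁻ x in D, ENNReal.ofReal (f (g x)) ∂ν) +
          (ENNReal.ofReal ε + ∫⁻ x in D, B.indicator 1 x ∂ν) := by
        have hBc : Measurable fun x => ENNReal.ofReal ε + B.indicator 1 x :=
          measurable_const.add hBi
        rw [lintegral_add_right _ hBc, lintegral_add_right _ hBi,
          setLIntegral_const, hνD, mul_one]
      _ ≤ μ {ω | sHat ω k ≠ s ω k} + (ENNReal.ofReal ε + ENNReal.ofReal ε) := by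
        rw [herr]; gcongr
      _ = _ := by rw [← ENNReal.ofReal_add hε hε, two_mul]
  rw [abs_le, measureReal_def]
  have hfin : μ {ω | sHat ω k ≠ s ω k} ≠ ∞ := measure_ne_top _ _
  constructor
  · have := ENNReal.toReal_mono (by finiteness) hlower
    rw [ENNReal.toReal_add hfin ENNReal.ofReal_ne_top, ENNReal.toReal_ofReal hx01.1,
      ENNReal.toReal_ofReal (by linarith)] at this
    linarith
  · have := ENNReal.toReal_mono (by finiteness) hupper
    rw [ENNReal.toReal_ofReal (by linarith [hx01.1])] at this
    linarith

theorem interior_noise_concentration {m n : ℕ} {Ω : Type*} [MeasurableSpace Ω] {μ : Measure Ω}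
    {ρ : ℂ} {σ β : ℝ} {H : Ω → Matrix (Fin m) (Fin n) ℂ}
    (hH : IsCircularGaussian (fun ω (p : Fin m × Fin n) => H ω p.1 p.2)
      (Matrix.kronecker (1 : Matrix (Fin m) (Fin m) ℂ) (kmsMatrix n ρ)) μ)
    (hσ : 0 < σ) (hm : (m : ℝ) = β * n) {k : Fin n} (h0 : 0 < (k : ℕ)) (h1 : (k : ℕ) + 1 < n)
    {τ δ : ℝ} (hτ : τ = (1 - ‖ρ‖ ^ 2) / (1 + ‖ρ‖ ^ 2)) (hτ0 : 0 ≤ τ) (hδ : 0 < δ)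
    (hn : τ / (σ ^ 2 * n) ≤ δ / 2) :
    μ {ω | ((H ω).conjTranspose * H ω).det ≠ 0 ∧
        δ ≤ |1 / noiseVar σ (H ω) k - (β - 1) * τ / σ ^ 2|} ≤
      ENNReal.ofReal (((β - 1) * n + 1) * Var[fun z => ‖z‖ ^ 2; cGauss τ.toNNReal] /
        (δ / 2 * (σ ^ 2 * n)) ^ 2) := by
  have hn0 : (0 : ℝ) < n := by exact_mod_cast k.pos
  obtain ⟨t, ht, hC⟩ := kms_interior (ρ := ρ) k h0 h1
  rw [← hτ] at hC
  have hP : 0 < σ ^ 2 * (n : ℝ) := by positivity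
  refine (measure_mono fun ω hω => ?_).trans
    ((channel_gram_inv_concentration hH ht hC (δ := δ / 2 * (σ ^ 2 * n))
      (by positivity)).trans_eq ?_)
  · refine ⟨hω.1, ?_⟩
    have h2 := hω.2
    have hq := (gram_inv_diag hω.1 k).1.2
    set q := (((H ω).conjTranspose * H ω)⁻¹ k k).re with hqdef
    -- The last term comes from the `+1` in the dimension `m - n + 1`; by `hn` it uses up at most
    -- half of `δ`, which leaves `δ / 2` for the concentration bound.
    have e1 : 1 / noiseVar σ (H ω) k - (β - 1) * τ / σ ^ 2 =
        (q⁻¹ - ((m : ℝ) - n + 1) * τ) / (σ ^ 2 * n) + τ / (σ ^ 2 * n) := by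
      rw [noiseVar, ← hqdef, hm]
      field_simp
      ring
    rw [e1] at h2
    have h3 := h2.trans (abs_add_le _ _)
    rw [abs_of_nonneg (a := τ / (σ ^ 2 * n)) (by positivity), abs_div, abs_of_pos hP] at h3
    have h4 : δ / 2 ≤ |q⁻¹ - ((m : ℝ) - n + 1) * τ| / (σ ^ 2 * n) := by linarith
    exact (le_div_iff₀ hP).1 h4
  · rw [hm]; ring_nf

theorem averageSEP_tendsto
    {ρ : ℂ} (hρ1 : ‖ρ‖ < 1) {σ β : ℝ} (hσ : 0 < σ) (hβ : 1 < β)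
    {nt nr : ℕ → ℕ} (hnt : Tendsto nt atTop atTop)
    (hratio : ∀ i, (nr i : ℝ) = β * (nt i : ℝ))
    {Ω : ℕ → Type*} [∀ i, MeasurableSpace (Ω i)]
    {μ : ∀ i, Measure (Ω i)} [∀ i, IsProbabilityMeasure (μ i)] {S : Set ℂ}
    {H : ∀ i, Ω i → Matrix (Fin (nr i)) (Fin (nt i)) ℂ}
    {s : ∀ i, Ω i → Fin (nt i) → ℂ} {ξ : ∀ i, Ω i → Fin (nr i) → ℂ}
    {sHat : ∀ i, Ω i → Fin (nt i) → ℂ}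
    (hlink : ∀ i, IsZFLink (μ i) S (kmsMatrix (nt i) ρ) (uniformPrecoder (nt i)) σ
      (H i) (s i) (ξ i) (sHat i))
    (hS : S.Finite) (hne : S.Nonempty)
    {f : ℝ → ℝ} (hf : ∀ v : ℝ≥0, v ≠ 0 →
      ∑ a ∈ hS.toFinset, (cGauss v).real (decisionRegion S a)ᶜ = S.ncard * f (1 / v))
    {x₀ : ℝ} (hx₀ : x₀ = (β - 1) * ((1 - ‖ρ‖ ^ 2) / (1 + ‖ρ‖ ^ 2)) / σ ^ 2)
    (hfc : ContinuousAt f x₀) :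
    Tendsto (fun i => averageSEP (μ i) (s i) (sHat i)) atTop (𝓝 (f x₀)) := by
  have hr2 : ‖ρ‖ ^ 2 < 1 := by nlinarith [norm_nonneg ρ]
  obtain ⟨τ, hτ⟩ : ∃ τ, τ = (1 - ‖ρ‖ ^ 2) / (1 + ‖ρ‖ ^ 2) := ⟨_, rfl⟩
  have hτ0 : 0 < τ := by rw [hτ]; exact div_pos (by linarith) (by positivity)
  rw [← hτ] at hx₀
  have hx0 : 0 < x₀ := by
    rw [hx₀]; exact div_pos (mul_pos (by linarith) hτ0) (by positivity)
  set K := Var[fun z => ‖z‖ ^ 2; cGauss τ.toNNReal] with hK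
  have hntR : Tendsto (fun i => (nt i : ℝ)) atTop atTop :=
    tendsto_natCast_atTop_atTop.comp hnt
  rw [Metric.tendsto_atTop']
  intro ε' hε'
  -- Half of `ε'` goes to the interior symbols, the other half to the two end symbols.
  obtain ⟨ε, hε, hεε⟩ : ∃ ε : ℝ, 0 < ε ∧ 2 * ε < ε' / 2 := ⟨ε' / 8, by linarith, by linarith⟩
  obtain ⟨δ, hδ, hclose⟩ := Metric.continuousAt_iff.1 hfc ε hε
  have hclose' (y : ℝ) (hy : |y - x₀| < δ) : |f y - f x₀| ≤ ε := (hclose hy).le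
  have ev1 : ∀ᶠ i in atTop, τ / (σ ^ 2 * nt i) ≤ δ / 2 := by
    have : Tendsto (fun i => τ / (σ ^ 2 * (nt i : ℝ))) atTop (𝓝 0) :=
      (hntR.const_mul_atTop (by positivity)).const_div_atTop τ
    exact (this.eventually_lt_const (by positivity)).mono fun i hi => hi.le
  -- The variance grows linearly in `nt i` and the squared deviation quadratically, so the Chebyshev
  -- bound decays like `1 / nt i`.
  have ev2 : ∀ᶠ i in atTop,
      ((β - 1) * nt i + 1) * K / (δ / 2 * (σ ^ 2 * nt i)) ^ 2 ≤ ε := by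
    have h1 : Tendsto (fun x : ℝ => ((β - 1) * x + 1) * K / (δ / 2 * (σ ^ 2 * x)) ^ 2)
        atTop (𝓝 0) := by
      have h2 : Tendsto (fun x : ℝ => ((β - 1) * x⁻¹ + x⁻¹ * x⁻¹) * (K / (δ / 2 * σ ^ 2) ^ 2))
          atTop (𝓝 (((β - 1) * 0 + 0 * 0) * (K / (δ / 2 * σ ^ 2) ^ 2))) :=
        ((tendsto_inv_atTop_zero.const_mul _).add
          (tendsto_inv_atTop_zero.mul tendsto_inv_atTop_zero)).mul_const _
      simp only [mul_zero, add_zero, zero_mul] at h2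
      refine h2.congr' ?_
      filter_upwards [eventually_gt_atTop 0] with x hx
      field_simp
    exact ((h1.comp hntR).eventually_lt_const hε).mono fun i hi => hi.le
  have ev3 : ∀ᶠ i in atTop, 2 / (nt i : ℝ) < ε' / 2 :=
    (hntR.const_div_atTop 2).eventually_lt_const (by linarith)
  have ev4 : ∀ᶠ i in atTop, 2 ≤ nt i := hnt.eventually_ge_atTop 2
  obtain ⟨N, hN⟩ := eventually_atTop.1 (ev1.and (ev2.and (ev3.and ev4)))
  refine ⟨N, fun i hi => ?_⟩
  obtain ⟨h1, h2, h3, h4⟩ := hN i hi.le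
  have hn0 : (0 : ℝ) < nt i := by exact_mod_cast (by omega : 0 < nt i)
  have hmn : nt i ≤ nr i := by
    have : (nt i : ℝ) ≤ nr i := by rw [hratio]; nlinarith
    exact_mod_cast this
  have hl := hlink i
  have hdet := channel_gram_det_ne_zero hl.channel hmn
    fun k => kms_innovation hρ1 (by omega) k
  let p (k : Fin (nt i)) : ℝ := (μ i).real {ω | sHat i ω k ≠ s i ω k}
  have hfx := errorRate_mem_Icc hS hne hf hx0
  have hint (k : Fin (nt i)) (k0 : 0 < (k : ℕ)) (k1 : (k : ℕ) + 1 < nt i) :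
      |p k - f x₀| ≤ 2 * ε := by
    refine symbolError_bound hl hσ hS hne hdet hf k hx0 hε.le hclose' ?_
    rw [hx₀]
    exact (interior_noise_concentration hl.channel hσ (hratio i) k0 k1 hτ hτ0.le hδ h1).trans
      (ENNReal.ofReal_le_ofReal h2)
  -- The end symbols have a different innovation variance, so they receive only the trivial bound
  -- `1`.
  have hall (k : Fin (nt i)) : |p k - f x₀| ≤ 2 * ε +
      ((if (k : ℕ) = 0 then 1 else 0) + (if (k : ℕ) = nt i - 1 then 1 else 0)) := by
    have hb : |p k - f x₀| ≤ 1 := by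
      have hp0 : 0 ≤ p k := measureReal_nonneg
      have hp1 : p k ≤ 1 := measureReal_le_one
      rw [abs_le]; constructor <;> linarith [hfx.1, hfx.2]
    by_cases k0 : (k : ℕ) = 0
    · rw [if_pos k0]; split_ifs <;> linarith
    · by_cases k1 : (k : ℕ) = nt i - 1
      · rw [if_pos k1]; split_ifs; linarith
      · rw [if_neg k0, if_neg k1, add_zero, add_zero]
        have := k.2
        exact hint k (by omega) (by omega)
  have hs0 : ∑ k : Fin (nt i), (if (k : ℕ) = 0 then (1 : ℝ) else 0) ≤ 1 := by
    rw [Fin.sum_univ_eq_sum_range (fun k => if k = 0 then (1 : ℝ) else 0),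
      Finset.sum_ite_eq']
    split_ifs <;> norm_num
  have hs1 : ∑ k : Fin (nt i), (if (k : ℕ) = nt i - 1 then (1 : ℝ) else 0) ≤ 1 := by
    rw [Fin.sum_univ_eq_sum_range (fun k => if k = nt i - 1 then (1 : ℝ) else 0),
      Finset.sum_ite_eq']
    split_ifs <;> norm_num
  have havg : averageSEP (μ i) (s i) (sHat i) - f x₀ =
      (1 / (nt i : ℝ)) * ∑ k, (p k - f x₀) := by
    rw [averageSEP, Finset.sum_sub_distrib, mul_sub]
    simp only [Finset.sum_const, Finset.card_univ, Fintype.card_fin, nsmul_eq_mul]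
    rw [← mul_assoc, one_div_mul_cancel hn0.ne', one_mul]
  rw [Real.dist_eq, havg, abs_mul, abs_of_pos (one_div_pos.2 hn0)]
  calc 1 / (nt i : ℝ) * |∑ k, (p k - f x₀)|
      ≤ 1 / (nt i : ℝ) * (nt i * (2 * ε) + (1 + 1)) := by
        gcongr
        refine (Finset.abs_sum_le_sum_abs _ _).trans
          ((Finset.sum_le_sum fun k _ => hall k).trans ?_)
        rw [Finset.sum_add_distrib, Finset.sum_add_distrib]
        simp only [Finset.sum_const, Finset.card_univ, Fintype.card_fin, nsmul_eq_mul]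
        linarith
    _ = 2 * ε + 2 / nt i := by field_simp; ring
    _ < ε' := by linarith

end limit

/-! ### The Gaussian tail function -/

section gaussian_tail

theorem integrable_exp_neg_sq_div_two : Integrable fun t : ℝ => Real.exp (-t ^ 2 / 2) := by
  have := integrable_exp_neg_mul_sq (b := 1 / 2) (by norm_num)
  refine this.congr (ae_of_all _ fun t => ?_)
  dsimp only
  congr 1
  ring

theorem continuous_gaussQ : Continuous gaussQ := by
  have h : gaussQ = fun x => (1 / Real.sqrt (2 * Real.pi)) *
      ((∫ t in Set.Ioi 0, Real.exp (-t ^ 2 / 2)) - ∫ t in (0 : ℝ)..x, Real.exp (-t ^ 2 / 2)) := by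
    funext x
    rw [gaussQ, ← intervalIntegral.integral_interval_add_Ioi
      integrable_exp_neg_sq_div_two.integrableOn integrable_exp_neg_sq_div_two.integrableOn
      (a := 0) (b := x), add_sub_cancel_left]
  rw [h]
  exact continuous_const.mul (continuous_const.sub
    (intervalIntegral.continuous_primitive
      (fun _ _ => integrable_exp_neg_sq_div_two.intervalIntegrable) 0))

theorem gaussianReal_Ioi {w : ℝ≥0} (hw : w ≠ 0) (x : ℝ) :
    (gaussianReal 0 w).real (Set.Ioi x) = gaussQ (x / Real.sqrt w) := by
  have hs : 0 < Real.sqrt w := Real.sqrt_pos.2 (by positivity)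
  have h1 : gaussianReal 0 w = (gaussianReal 0 1).map (Real.sqrt w * ·) := by
    rw [gaussianReal_map_const_mul, mul_zero, mul_one]
    congr 1
    ext
    exact (Real.sq_sqrt w.2).symm
  rw [h1, map_measureReal_apply (by fun_prop) measurableSet_Ioi]
  have h2 : (Real.sqrt w * ·) ⁻¹' Set.Ioi x = Set.Ioi (x / Real.sqrt w) := by
    ext y
    simp [div_lt_iff₀' hs]
  rw [h2, measureReal_def, gaussianReal_apply_eq_integral _ one_ne_zero,
    ENNReal.toReal_ofReal (setIntegral_nonneg measurableSet_Ioi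
      fun y _ => gaussianPDFReal_nonneg _ _ _), gaussQ, ← integral_const_mul]
  refine setIntegral_congr_fun measurableSet_Ioi fun y _ => ?_
  simp [gaussianPDFReal]

theorem gaussianReal_Iio_neg {w : ℝ≥0} (hw : w ≠ 0) (x : ℝ) :
    (gaussianReal 0 w).real (Set.Iio (-x)) = gaussQ (x / Real.sqrt w) := by
  have h := gaussianReal_map_neg (μ := 0) (v := w)
  rw [neg_zero] at h
  rw [← gaussianReal_Ioi hw, ← h, map_measureReal_apply (by fun_prop) measurableSet_Iio, h]
  congr 1
  ext y
  simp

end gaussian_tail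

/-! ### Error probability of rectangular grids -/

section grid

/-- The noise values for which the `m`-th of `M` points at spacing `2 * c` is nearest. -/
def lineRegion (M : ℕ) (c : ℝ) (m : Fin M) : Set ℝ :=
  {x | ∀ m' : Fin M, x ^ 2 ≤ (x + c * (2 * (m : ℝ) - 2 * (m' : ℝ))) ^ 2}

variable {M : ℕ} {c : ℝ}

/-- Only immediate neighbours matter: an error means crossing a midpoint at distance `c`, and an
extreme point has no neighbour on its outer side. -/
theorem compl_lineRegion (hc : 0 < c) (m : Fin M) :
    (lineRegion M c m)ᶜ = (if 0 < (m : ℕ) then Set.Iio (-c) else ∅) ∪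
      (if (m : ℕ) + 1 < M then Set.Ioi c else ∅) := by
  ext x
  have hneg (j : ℝ) : (x + c * j) ^ 2 < x ^ 2 ↔ c * (j * (2 * x + c * j)) < 0 := by
    constructor <;> intro h <;> nlinarith
  simp only [lineRegion, Set.mem_compl_iff, Set.mem_ofPred_eq, not_forall, not_le, Set.mem_union]
  constructor
  · rintro ⟨m', h⟩
    rw [hneg] at h
    have h := (pos_iff_neg_of_mul_neg h).1 hc
    rcases lt_trichotomy (m : ℕ) m' with hlt | heq | hgt
    · right
      rw [if_pos (by have := m'.2; omega)]
      have h1 : (m : ℝ) + 1 ≤ m' := by exact_mod_cast hlt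
      have h2 : 0 < 2 * x + c * (2 * (m : ℝ) - 2 * (m' : ℝ)) := by
        by_contra hcon
        push Not at hcon
        have := mul_nonneg_of_nonpos_of_nonpos (by linarith : 2 * (m : ℝ) - 2 * (m' : ℝ) ≤ 0) hcon
        linarith
      rw [Set.mem_Ioi]
      nlinarith
    · simp [heq] at h
    · left
      rw [if_pos (by omega)]
      have h1 : (m' : ℝ) + 1 ≤ m := by exact_mod_cast hgt
      have h2 : 2 * x + c * (2 * (m : ℝ) - 2 * (m' : ℝ)) < 0 := by
        by_contra hcon
        push Not at hcon
        have := mul_nonneg (by linarith : 0 ≤ 2 * (m : ℝ) - 2 * (m' : ℝ)) hcon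
        linarith
      rw [Set.mem_Iio]
      nlinarith
  · rintro (h | h)
    · split_ifs at h with hm
      · rw [Set.mem_Iio] at h
        refine ⟨⟨m - 1, by omega⟩, ?_⟩
        have : ((⟨(m : ℕ) - 1, by omega⟩ : Fin M) : ℕ) = (m : ℕ) - 1 := rfl
        rw [this, Nat.cast_sub hm, hneg]
        have e : 2 * (m : ℝ) - 2 * ((m : ℝ) - ((1 : ℕ) : ℝ)) = 2 := by push_cast; ring
        rw [e]
        nlinarith
      · exact absurd h (Set.notMem_empty x)
    · split_ifs at h with hm
      · rw [Set.mem_Ioi] at h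
        refine ⟨⟨m + 1, hm⟩, ?_⟩
        have : ((⟨(m : ℕ) + 1, hm⟩ : Fin M) : ℕ) = (m : ℕ) + 1 := rfl
        rw [this, hneg]
        have e : 2 * (m : ℝ) - 2 * (((m : ℕ) + 1 : ℕ) : ℝ) = -2 := by push_cast; ring
        rw [e]
        nlinarith
      · exact absurd h (Set.notMem_empty x)

theorem measurableSet_lineRegion (m : Fin M) : MeasurableSet (lineRegion M c m) := by
  have : lineRegion M c m =
      ⋂ m' : Fin M, {x | x ^ 2 ≤ (x + c * (2 * (m : ℝ) - 2 * (m' : ℝ))) ^ 2} := by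
    ext x; simp [lineRegion]
  rw [this]
  exact MeasurableSet.iInter fun _ => measurableSet_le (by fun_prop) (by fun_prop)

/-- Each of the `M - 1` gaps between neighbours costs two tails, one from either side. The left and
right ends are counted separately, so `M = 1` is covered as well. -/
theorem sum_gaussianReal_lineRegion (hM : 1 ≤ M) (hc : 0 < c) {w : ℝ≥0} (hw : w ≠ 0) :
    ∑ m, (gaussianReal 0 w).real (lineRegion M c m) =
      M - 2 * ((M : ℝ) - 1) * gaussQ (c / Real.sqrt w) := by
  have h1 (m : Fin M) : (gaussianReal 0 w).real (lineRegion M c m) =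
      1 - ((if (m : ℕ) = 0 then 0 else 1) + (if (m : ℕ) = M - 1 then 0 else 1)) *
        gaussQ (c / Real.sqrt w) := by
    have h2 := probReal_compl_eq_one_sub (μ := gaussianReal 0 w)
      (measurableSet_lineRegion (c := c) m).compl
    rw [compl_compl] at h2
    rw [h2, compl_lineRegion hc, measureReal_union]
    · congr 1
      rw [add_mul]
      congr 1
      · by_cases h : (m : ℕ) = 0
        · simp [h]
        · rw [if_pos (Nat.pos_of_ne_zero h), if_neg h, one_mul, gaussianReal_Iio_neg hw]
      · have := m.2
        by_cases h : (m : ℕ) = M - 1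
        · rw [if_neg (by omega), if_pos h]; simp
        · rw [if_pos (by omega), if_neg h, one_mul, gaussianReal_Ioi hw]
    · refine Set.disjoint_left.2 fun x hx hx' => ?_
      split_ifs at hx hx' <;> simp at hx hx'
      linarith
    · split_ifs <;> simp
  have e0 : ∑ m : Fin M, (if (m : ℕ) = 0 then (0 : ℝ) else 1) = M - 1 := by
    have : ∀ m : Fin M,
        (if (m : ℕ) = 0 then (0 : ℝ) else 1) = 1 - if (m : ℕ) = 0 then 1 else 0 := by
      intro m; split_ifs <;> norm_num
    simp only [this, Finset.sum_sub_distrib]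
    rw [Fin.sum_univ_eq_sum_range (fun k => if k = 0 then (1 : ℝ) else 0), Finset.sum_ite_eq',
      if_pos (by simp; omega)]
    simp
  have e1 : ∑ m : Fin M, (if (m : ℕ) = M - 1 then (0 : ℝ) else 1) = M - 1 := by
    have : ∀ m : Fin M, (if (m : ℕ) = M - 1 then (0 : ℝ) else 1) =
        1 - if (m : ℕ) = M - 1 then 1 else 0 := by
      intro m; split_ifs <;> norm_num
    simp only [this, Finset.sum_sub_distrib]
    rw [Fin.sum_univ_eq_sum_range (fun k => if k = M - 1 then (1 : ℝ) else 0), Finset.sum_ite_eq',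
      if_pos (by simp; omega)]
    simp
  simp only [h1, Finset.sum_sub_distrib, ← Finset.sum_mul, Finset.sum_add_distrib, e0, e1,
    Finset.sum_const, Finset.card_univ, Fintype.card_fin, nsmul_eq_mul]
  ring

/-- The points of a centred rectangular grid of spacing `2 * c`. -/
def gridPoint (M N : ℕ) (c : ℝ) (p : Fin M × Fin N) : ℂ :=
  (c : ℂ) * (((2 * (p.1 : ℝ) + 1 - (M : ℝ) : ℝ) : ℂ) +
    ((2 * (p.2 : ℝ) + 1 - (N : ℝ) : ℝ) : ℂ) * Complex.I)

variable {N : ℕ}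

theorem gridPoint_re (p : Fin M × Fin N) : (gridPoint M N c p).re = c * (2 * p.1 + 1 - M) := by
  simp [gridPoint]

theorem gridPoint_im (p : Fin M × Fin N) : (gridPoint M N c p).im = c * (2 * p.2 + 1 - N) := by
  simp [gridPoint]

theorem gridPoint_injective (hc : 0 < c) : Function.Injective (gridPoint M N c) := by
  intro p q h
  have h1 := congrArg Complex.re h
  have h2 := congrArg Complex.im h
  rw [gridPoint_re, gridPoint_re] at h1
  rw [gridPoint_im, gridPoint_im] at h2
  have h3 := mul_left_cancel₀ hc.ne' h1
  have h4 := mul_left_cancel₀ hc.ne' h2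
  have h5 : (p.1 : ℝ) = q.1 := by linarith
  have h6 : (p.2 : ℝ) = q.2 := by linarith
  exact Prod.ext (Fin.ext (by exact_mod_cast h5)) (Fin.ext (by exact_mod_cast h6))

/-- Squared distances split by coordinates; comparison with points in the same row or column gives
both one-dimensional conditions, and adding these recovers all others. -/
theorem decisionRegion_grid (p : Fin M × Fin N) :
    decisionRegion (Set.range (gridPoint M N c)) (gridPoint M N c p) =
      {z | z.re ∈ lineRegion M c p.1 ∧ z.im ∈ lineRegion N c p.2} := by
  ext z
  have hn (q : Fin M × Fin N) : ‖z‖ ≤ ‖z + gridPoint M N c p - gridPoint M N c q‖ ↔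
      z.re ^ 2 + z.im ^ 2 ≤ (z.re + c * (2 * (p.1 : ℝ) - 2 * (q.1 : ℝ))) ^ 2 +
        (z.im + c * (2 * (p.2 : ℝ) - 2 * (q.2 : ℝ))) ^ 2 := by
    rw [Complex.norm_def, Complex.norm_def, Real.sqrt_le_sqrt_iff (Complex.normSq_nonneg _),
      Complex.normSq_apply, Complex.normSq_apply]
    simp only [Complex.add_re, Complex.sub_re, Complex.add_im, Complex.sub_im, gridPoint_re,
      gridPoint_im]
    constructor <;> intro h <;> nlinarith
  simp only [decisionRegion, Set.forall_mem_range, Set.mem_ofPred_eq, hn, lineRegion]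
  constructor
  · intro h
    refine ⟨fun m' => ?_, fun m' => ?_⟩
    · have := h (m', p.2)
      simpa using this
    · have := h (p.1, m')
      simpa using this
  · rintro ⟨h1, h2⟩ q
    exact add_le_add (h1 q.1) (h2 q.2)

theorem cGauss_rectangle (v : ℝ≥0) (A B : Set ℝ) :
    (cGauss v).real {z | z.re ∈ A ∧ z.im ∈ B} =
      (gaussianReal 0 (v / 2)).real A * (gaussianReal 0 (v / 2)).real B := by
  rw [← measureReal_prod_prod, measureReal_def, cGauss, MeasurableEquiv.map_apply]
  rfl

theorem sum_grid_error (hM : 1 ≤ M) (hN : 1 ≤ N) (hc : 0 < c)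
    (hS : (Set.range (gridPoint M N c)).Finite) {v : ℝ≥0} (hv : v ≠ 0) :
    ∑ a ∈ hS.toFinset, (cGauss v).real (decisionRegion (Set.range (gridPoint M N c)) a)ᶜ =
      (Set.range (gridPoint M N c)).ncard *
      (1 - (1 - 2 * ((M : ℝ) - 1) / M * gaussQ (Real.sqrt (2 * c ^ 2 * (1 / v)))) *
        (1 - 2 * ((N : ℝ) - 1) / N * gaussQ (Real.sqrt (2 * c ^ 2 * (1 / v))))) := by
  have hw : v / 2 ≠ 0 := div_ne_zero hv two_ne_zero
  -- Each real component of the noise has variance `v / 2`, whence the factor `2`.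
  have hq : c / Real.sqrt ((v / 2 : ℝ≥0) : ℝ) = Real.sqrt (2 * c ^ 2 * (1 / v)) := by
    have hv0 : (0 : ℝ) < v := by positivity
    rw [NNReal.coe_div, NNReal.coe_ofNat]
    rw [eq_comm, Real.sqrt_eq_iff_mul_self_eq (by positivity) (by positivity)]
    rw [div_mul_div_comm, Real.mul_self_sqrt (by positivity)]
    field_simp
  have hfin : hS.toFinset = Finset.univ.image (gridPoint M N c) := by
    ext z; simp
  have hcard : (Set.range (gridPoint M N c)).ncard = M * N := by
    rw [← Set.image_univ, Set.ncard_image_of_injective _ (gridPoint_injective hc), Set.ncard_univ]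
    simp
  rw [hcard, hfin, Finset.sum_image (gridPoint_injective hc).injOn]
  have h1 (p : Fin M × Fin N) : (cGauss v).real
      (decisionRegion (Set.range (gridPoint M N c)) (gridPoint M N c p))ᶜ =
      1 - (gaussianReal 0 (v / 2)).real (lineRegion M c p.1) *
        (gaussianReal 0 (v / 2)).real (lineRegion N c p.2) := by
    rw [probReal_compl_eq_one_sub (measurableSet_decisionRegion hS _), decisionRegion_grid,
      cGauss_rectangle]
  simp only [h1, Finset.sum_sub_distrib, Fintype.sum_prod_type, ← Finset.mul_sum]
  rw [← Finset.sum_mul, sum_gaussianReal_lineRegion hM hc hw, sum_gaussianReal_lineRegion hN hc hw,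
    hq]
  have hM0 : (M : ℝ) ≠ 0 := by exact_mod_cast (by omega : M ≠ 0)
  have hN0 : (N : ℝ) ≠ 0 := by exact_mod_cast (by omega : N ≠ 0)
  simp
  field_simp

end grid

/-! ### Craig's formula in polar coordinates -/

section polar

/-- The density of `cGauss v`. -/
def cGaussPDF (v : ℝ≥0) (z : ℂ) : ℝ := (Real.pi * v)⁻¹ * Real.exp (-‖z‖ ^ 2 / v)

theorem cGauss_apply {v : ℝ≥0} (hv : v ≠ 0) {W : Set ℂ} (hW : MeasurableSet W) :
    cGauss v W = ∫⁻ z in W, ENNReal.ofReal (cGaussPDF v z) := by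
  have hw : v / 2 ≠ 0 := div_ne_zero hv two_ne_zero
  have hv0 : (0 : ℝ) < v := by positivity
  rw [cGauss, MeasurableEquiv.map_apply, gaussianReal_of_var_ne_zero 0 hw,
    prod_withDensity (measurable_gaussianPDF _ _) (measurable_gaussianPDF _ _),
    withDensity_apply _ (Complex.measurableEquivRealProd.symm.measurable hW),
    ← Complex.volume_preserving_equiv_real_prod.symm.setLIntegral_comp_preimage_emb
      Complex.measurableEquivRealProd.symm.measurableEmbedding]
  refine lintegral_congr fun p => ?_
  rw [gaussianPDF, gaussianPDF, ← ENNReal.ofReal_mul (gaussianPDFReal_nonneg _ _ _)]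
  congr 1
  have hn : ‖Complex.measurableEquivRealProd.symm p‖ ^ 2 = p.1 ^ 2 + p.2 ^ 2 := by
    rw [Complex.sq_norm, Complex.normSq_apply, Complex.measurableEquivRealProd_symm_apply]
    ring
  have h2 : (2 : ℝ) * Real.pi * ((v / 2 : ℝ≥0) : ℝ) = Real.pi * v := by
    rw [NNReal.coe_div, NNReal.coe_ofNat]; ring
  have h3 : (2 : ℝ) * ((v / 2 : ℝ≥0) : ℝ) = v := by
    rw [NNReal.coe_div, NNReal.coe_ofNat]; ring
  rw [cGaussPDF, gaussianPDFReal, gaussianPDFReal, hn, h2, h3, mul_mul_mul_comm, ← mul_inv,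
    Real.mul_self_sqrt (by positivity), ← Real.exp_add]
  congr 2
  ring

/-- The density depends on the modulus only, and rotations preserve Lebesgue measure. -/
theorem cGauss_rotate {v : ℝ≥0} (hv : v ≠ 0) {W : Set ℂ} (hW : MeasurableSet W) (u : Circle) :
    cGauss v ((fun z => u * z) ⁻¹' W) = cGauss v W := by
  have hp : MeasurePreserving (rotation u) := (rotation u).measurePreserving
  have he : MeasurableEmbedding (rotation u) :=
    (rotation u).toHomeomorph.measurableEmbedding
  have h1 : (fun z : ℂ => u * z) = rotation u := by
    funext z; rw [rotation_apply]
  rw [h1, cGauss_apply hv hW, cGauss_apply hv (he.measurable hW),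
    ← hp.setLIntegral_comp_preimage_emb he (fun z => ENNReal.ofReal (cGaussPDF v z)) W]
  refine lintegral_congr fun z => ?_
  rw [cGaussPDF, cGaussPDF, LinearIsometryEquiv.norm_map]

theorem lintegral_Ioi_mul_exp {v a : ℝ} (hv : 0 < v) (ha : 0 ≤ a) :
    ∫⁻ r in Set.Ioi a, ENNReal.ofReal (r * ((Real.pi * v)⁻¹ * Real.exp (-r ^ 2 / v))) =
      ENNReal.ofReal ((2 * Real.pi)⁻¹ * Real.exp (-a ^ 2 / v)) := by
  have hd (r : ℝ) (_ : r ∈ Set.Ici a) :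
      HasDerivAt (fun r => -((2 * Real.pi)⁻¹ * Real.exp (-r ^ 2 / v)))
        (r * ((Real.pi * v)⁻¹ * Real.exp (-r ^ 2 / v))) r := by
    have h0 : HasDerivAt (fun r : ℝ => -r ^ 2 / v) (-(2 * r) / v) r := by
      simpa using ((hasDerivAt_pow 2 r).fun_neg).div_const v
    refine ((h0.exp.const_mul ((2 * Real.pi)⁻¹)).fun_neg).congr_deriv ?_
    have := Real.pi_ne_zero
    field_simp
  have hpos (r : ℝ) (hr : r ∈ Set.Ioi a) :
      0 ≤ r * ((Real.pi * v)⁻¹ * Real.exp (-r ^ 2 / v)) := by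
    have : 0 < r := lt_of_le_of_lt ha hr
    positivity
  have hlim : Tendsto (fun r : ℝ => -((2 * Real.pi)⁻¹ * Real.exp (-r ^ 2 / v))) atTop (𝓝 0) := by
    have h1 : Tendsto (fun r : ℝ => -r ^ 2 / v) atTop atBot := by
      have : Tendsto (fun r : ℝ => r ^ 2 / v) atTop atTop :=
        (tendsto_pow_atTop two_ne_zero).atTop_div_const hv
      refine (tendsto_neg_atTop_atBot.comp this).congr fun r => ?_
      simp [neg_div]
    have h2 := ((Real.tendsto_exp_atBot.comp h1).const_mul ((2 * Real.pi)⁻¹)).neg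
    simpa using h2
  rw [← ofReal_integral_eq_lintegral_ofReal (integrableOn_Ioi_deriv_of_nonneg' hd hpos hlim)
    ((ae_restrict_iff' measurableSet_Ioi).2 (ae_of_all _ hpos)),
    integral_Ioi_of_hasDerivAt_of_nonneg' hd hpos hlim, zero_sub, neg_neg]

/-- The complement of a wedge of half-angle `c` centred at the origin, seen from the point `1`. -/
def wedgeError (c : ℝ) : Set ℂ := {z | (1 + z.re) * Real.sin c < |z.im| * Real.cos c}

theorem measurableSet_wedgeError (c : ℝ) : MeasurableSet (wedgeError c) :=
  measurableSet_lt (by fun_prop) (by fun_prop)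

/-- The angular density of the probability of leaving the wedge. -/
def wedgeAngular (v c φ : ℝ) : ℝ :=
  if 0 < Real.sin (|φ| - c) then
    (2 * Real.pi)⁻¹ * Real.exp (-(Real.sin c / Real.sin (|φ| - c)) ^ 2 / v)
  else 0

theorem measurable_wedgeAngular (v c : ℝ) : Measurable (wedgeAngular v c) := by
  unfold wedgeAngular
  exact Measurable.ite (measurableSet_lt (by fun_prop) (by fun_prop)) (by fun_prop) (by fun_prop)

theorem wedgeAngular_bounds {v : ℝ} (hv : 0 < v) (c φ : ℝ) :
    0 ≤ wedgeAngular v c φ ∧ wedgeAngular v c φ ≤ (2 * Real.pi)⁻¹ := by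
  have hpi := Real.pi_pos
  unfold wedgeAngular
  split_ifs
  · refine ⟨by positivity, ?_⟩
    refine mul_le_of_le_one_right (by positivity) (Real.exp_le_one_iff.2 ?_)
    exact div_nonpos_of_nonpos_of_nonneg (neg_nonpos.2 (sq_nonneg _)) hv.le
  · exact ⟨le_rfl, by positivity⟩

/-- The ray at angle `φ` is outside the wedge exactly for `r > sin c / sin (|φ| - c)` when the
denominator is positive, and never otherwise; the radial integral is then explicit. -/
theorem cGauss_wedgeError_lintegral {v : ℝ≥0} (hv : v ≠ 0) {c : ℝ} (hc : 0 < Real.sin c) :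
    cGauss v (wedgeError c) =
      ∫⁻ φ in Set.Ioo (-Real.pi) Real.pi, ENNReal.ofReal (wedgeAngular v c φ) := by
  have hv0 : (0 : ℝ) < v := by positivity
  have hWm := measurableSet_wedgeError c
  have hpm : Measurable fun z => ENNReal.ofReal (cGaussPDF v z) := by
    unfold cGaussPDF; fun_prop
  have hP : Measurable fun p : ℝ × ℝ => Complex.polarCoord.symm p := by
    have : (fun p : ℝ × ℝ => Complex.polarCoord.symm p) =
        fun p : ℝ × ℝ => (p.1 : ℂ) * (Real.cos p.2 + Real.sin p.2 * Complex.I) := by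
      funext p; rw [Complex.polarCoord_symm_apply]
    rw [this]
    fun_prop
  rw [cGauss_apply hv hWm, ← lintegral_indicator hWm, ← Complex.lintegral_comp_polarCoord_symm]
  have hmeas : Measurable fun p : ℝ × ℝ => ENNReal.ofReal p.1 •
      (wedgeError c).indicator (fun z => ENNReal.ofReal (cGaussPDF v z))
        (Complex.polarCoord.symm p) :=
    (measurable_fst.ennreal_ofReal).mul ((hpm.indicator hWm).comp hP)
  have ht : polarCoord.target = Set.Ioi (0 : ℝ) ×ˢ Set.Ioo (-Real.pi) Real.pi := rfl
  rw [ht, Measure.volume_eq_prod, setLIntegral_prod_symm _ hmeas.aemeasurable]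
  refine setLIntegral_congr_fun measurableSet_Ioo fun φ hφ => ?_
  have habs : |Real.sin φ| = Real.sin |φ| := by
    rcases le_total 0 φ with h | h
    · rw [abs_of_nonneg h, abs_of_nonneg (Real.sin_nonneg_of_nonneg_of_le_pi h hφ.2.le)]
    · rw [abs_of_nonpos h, Real.sin_neg,
        abs_of_nonpos (Real.sin_nonpos_of_nonpos_of_neg_pi_le h hφ.1.le)]
  have hmem (r : ℝ) (hr : 0 < r) : Complex.polarCoord.symm (r, φ) ∈ wedgeError c ↔
      Real.sin c < r * Real.sin (|φ| - c) := by
    rw [wedgeError, Set.mem_ofPred_eq, Complex.polarCoord_symm_apply, Real.sin_sub, Real.cos_abs,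
      ← habs]
    have h1 : ((r : ℂ) * (Real.cos φ + Real.sin φ * Complex.I)).re = r * Real.cos φ := by
      rw [Complex.re_ofReal_mul]
      simp [-Complex.ofReal_cos]
    have h2 : ((r : ℂ) * (Real.cos φ + Real.sin φ * Complex.I)).im = r * Real.sin φ := by
      rw [Complex.im_ofReal_mul]
      simp [-Complex.ofReal_sin]
    rw [h1, h2, abs_mul, abs_of_pos hr]
    constructor <;> intro h <;> linarith
  have hnorm (r : ℝ) (hr : 0 < r) : ‖Complex.polarCoord.symm (r, φ)‖ = r := by
    rw [Complex.norm_polarCoord_symm, abs_of_pos hr]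
  by_cases hs : 0 < Real.sin (|φ| - c)
  · have ha : 0 < Real.sin c / Real.sin (|φ| - c) := div_pos hc hs
    have hsub : Set.Ioi (Real.sin c / Real.sin (|φ| - c)) ∩ Set.Ioi (0 : ℝ) =
        Set.Ioi (Real.sin c / Real.sin (|φ| - c)) :=
      Set.inter_eq_left.2 (Set.Ioi_subset_Ioi ha.le)
    rw [wedgeAngular, if_pos hs, ← lintegral_Ioi_mul_exp hv0 ha.le, ← hsub,
      ← setLIntegral_indicator measurableSet_Ioi]
    refine setLIntegral_congr_fun measurableSet_Ioi fun r hr => ?_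
    have hr0 : 0 < r := hr
    by_cases hm : Complex.polarCoord.symm (r, φ) ∈ wedgeError c
    · have hm' : r ∈ Set.Ioi (Real.sin c / Real.sin (|φ| - c)) :=
        (div_lt_iff₀ hs).2 ((hmem r hr0).1 hm)
      rw [Set.indicator_of_mem hm, Set.indicator_of_mem hm', smul_eq_mul, cGaussPDF, hnorm r hr0,
        ENNReal.ofReal_mul hr0.le]
    · have hm' : r ∉ Set.Ioi (Real.sin c / Real.sin (|φ| - c)) := fun h =>
        hm ((hmem r hr0).2 ((div_lt_iff₀ hs).1 h))
      rw [Set.indicator_of_notMem hm, Set.indicator_of_notMem hm', smul_zero]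
  · rw [wedgeAngular, if_neg hs, ENNReal.ofReal_zero,
      ← lintegral_zero (μ := (volume : Measure ℝ).restrict (Set.Ioi (0 : ℝ)))]
    refine setLIntegral_congr_fun measurableSet_Ioi fun r hr => ?_
    have hr0 : 0 < r := hr
    have hm : Complex.polarCoord.symm (r, φ) ∉ wedgeError c := fun h => by
      have h1 := (hmem r hr0).1 h
      have h2 : r * Real.sin (|φ| - c) ≤ 0 :=
        mul_nonpos_of_nonneg_of_nonpos hr0.le (not_lt.1 hs)
      linarith
    rw [Set.indicator_of_notMem hm, smul_zero]

/-- Craig's formula for the probability that complex Gaussian noise leaves a wedge. -/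
theorem cGauss_wedgeError {v : ℝ≥0} (hv : v ≠ 0) {c : ℝ} (hc0 : 0 < c) (hcpi : c < Real.pi) :
    (cGauss v).real (wedgeError c) = (1 / Real.pi) * ∫ θ in (0 : ℝ)..(Real.pi - c),
      Real.exp (-(1 / (v : ℝ) * Real.sin c ^ 2 / Real.sin θ ^ 2)) := by
  have hv0 : (0 : ℝ) < v := by positivity
  have hpi := Real.pi_pos
  have hb := wedgeAngular_bounds hv0 c
  have hint : Integrable (wedgeAngular v c) (volume.restrict (Set.Ioo (-Real.pi) Real.pi)) :=
    Integrable.of_bound (measurable_wedgeAngular _ _).aestronglyMeasurable ((2 * Real.pi)⁻¹)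
      (ae_of_all _ fun φ => by rw [Real.norm_of_nonneg (hb φ).1]; exact (hb φ).2)
  have hii (a b : ℝ) : IntervalIntegrable (wedgeAngular v c) volume a b := by
    rw [intervalIntegrable_iff, Set.uIoc]
    exact Integrable.of_bound (measurable_wedgeAngular _ _).aestronglyMeasurable ((2 * Real.pi)⁻¹)
      (ae_of_all _ fun φ => by rw [Real.norm_of_nonneg (hb φ).1]; exact (hb φ).2)
  rw [measureReal_def, cGauss_wedgeError_lintegral hv (Real.sin_pos_of_pos_of_lt_pi hc0 hcpi),
    ← ofReal_integral_eq_lintegral_ofReal hint (ae_of_all _ fun φ => (hb φ).1),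
    ENNReal.toReal_ofReal (integral_nonneg fun φ => (hb φ).1), ← integral_Ioc_eq_integral_Ioo,
    ← intervalIntegral.integral_of_le (by linarith),
    ← intervalIntegral.integral_add_adjacent_intervals (hii _ 0) (hii 0 _)]
  -- Evenness doubles the integral over `[0, π]`, which turns `1/(2π)` into `1/π`. Rays with angle
  -- at most `c` never leave the wedge, and on the rest the substitution `θ = φ - c` gives Craig's
  -- integrand.
  have hneg : ∫ φ in (-Real.pi)..0, wedgeAngular v c φ = ∫ φ in (0 : ℝ)..Real.pi,
      wedgeAngular v c φ := by
    have h1 := intervalIntegral.integral_comp_neg (a := 0) (b := Real.pi) (wedgeAngular v c)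
    rw [neg_zero] at h1
    rw [← h1]
    refine intervalIntegral.integral_congr fun φ _ => ?_
    simp [wedgeAngular]
  have hzero : ∫ φ in (0 : ℝ)..c, wedgeAngular v c φ = 0 := by
    rw [intervalIntegral.integral_congr (g := fun _ => (0 : ℝ)), intervalIntegral.integral_zero]
    intro φ hφ
    rw [Set.uIcc_of_le hc0.le] at hφ
    have : Real.sin (|φ| - c) ≤ 0 := by
      rw [abs_of_nonneg hφ.1]
      exact Real.sin_nonpos_of_nonpos_of_neg_pi_le (by linarith [hφ.2]) (by linarith [hφ.1])
    simp [wedgeAngular, not_lt.2 this]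
  have htail : ∫ φ in c..Real.pi, wedgeAngular v c φ = (2 * Real.pi)⁻¹ *
      ∫ θ in (0 : ℝ)..(Real.pi - c),
        Real.exp (-(1 / (v : ℝ) * Real.sin c ^ 2 / Real.sin θ ^ 2)) := by
    have h1 := intervalIntegral.integral_comp_sub_right (a := c) (b := Real.pi)
      (fun θ => Real.exp (-(1 / (v : ℝ) * Real.sin c ^ 2 / Real.sin θ ^ 2))) c
    rw [sub_self] at h1
    rw [← h1, ← intervalIntegral.integral_const_mul]
    refine intervalIntegral.integral_congr_ae (ae_of_all _ fun φ hφ => ?_)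
    rw [Set.uIoc_of_le hcpi.le] at hφ
    have hs : 0 < Real.sin (|φ| - c) := by
      rw [abs_of_nonneg (hc0.le.trans hφ.1.le)]
      exact Real.sin_pos_of_pos_of_lt_pi (by linarith [hφ.1]) (by linarith [hφ.2])
    rw [wedgeAngular, if_pos hs]
    rw [abs_of_nonneg (hc0.le.trans hφ.1.le)] at hs ⊢
    congr 2
    field_simp
  rw [hneg, ← intervalIntegral.integral_add_adjacent_intervals (hii 0 c) (hii c _), hzero, htail]
  field_simp
  ring

/-- Dominated convergence with bound `1`, valid for positive `x`. Where `sin θ = 0`, division by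
zero makes the integrand the constant `1`, which is continuous in `x` too. -/
theorem continuousAt_craig (c b x₀ : ℝ) (hx₀ : 0 < x₀) :
    ContinuousAt (fun x : ℝ => (1 / Real.pi) * ∫ θ in (0 : ℝ)..b,
      Real.exp (-(x * Real.sin c ^ 2 / Real.sin θ ^ 2))) x₀ := by
  refine continuousAt_const.mul
    (intervalIntegral.continuousAt_of_dominated_interval (bound := fun _ => 1) ?_ ?_ ?_ ?_)
  · refine Eventually.of_forall fun x => Measurable.aestronglyMeasurable ?_
    fun_prop
  · filter_upwards [lt_mem_nhds hx₀] with x hx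
    refine ae_of_all _ fun θ _ => ?_
    rw [Real.norm_of_nonneg (Real.exp_pos _).le, Real.exp_le_one_iff]
    have : 0 ≤ x * Real.sin c ^ 2 / Real.sin θ ^ 2 := by positivity
    linarith
  · exact intervalIntegrable_const
  · refine ae_of_all _ fun θ _ => ?_
    fun_prop

end polar

/-! ### PSK: wedge regions and rotational symmetry -/

section psk

variable {M : ℕ}

/-- The points of the `M`-ary PSK constellation. -/
def pskPoint (M : ℕ) (m : Fin M) : ℂ :=
  Complex.exp (2 * (Real.pi : ℂ) * Complex.I * (m : ℂ) / (M : ℂ))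

theorem pskPoint_eq (m : Fin M) :
    pskPoint M m = Complex.exp ((2 * (m * (Real.pi / M)) : ℝ) * Complex.I) := by
  rw [pskPoint]
  congr 1
  push_cast
  ring

theorem pskPoint_re (m : Fin M) : (pskPoint M m).re = Real.cos (2 * (m * (Real.pi / M))) := by
  rw [pskPoint_eq, Complex.exp_ofReal_mul_I_re]

theorem pskPoint_im (m : Fin M) : (pskPoint M m).im = Real.sin (2 * (m * (Real.pi / M))) := by
  rw [pskPoint_eq, Complex.exp_ofReal_mul_I_im]

theorem norm_pskPoint (m : Fin M) : ‖pskPoint M m‖ = 1 := by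
  rw [pskPoint_eq, Complex.norm_exp_ofReal_mul_I]

theorem pskConstellation_eq (hM : 1 ≤ M) : pskConstellation M = {z : ℂ | z ^ M = 1} := by
  have hM0 : M ≠ 0 := by omega
  have hp := Complex.isPrimitiveRoot_exp M hM0
  ext z
  simp only [pskConstellation, Set.mem_range, Set.mem_ofPred_eq]
  have he (i : ℕ) : Complex.exp (2 * (Real.pi : ℂ) * Complex.I / (M : ℂ)) ^ i =
      Complex.exp (2 * (Real.pi : ℂ) * Complex.I * (i : ℂ) / (M : ℂ)) := by
    rw [← Complex.exp_nat_mul]; congr 1; ring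
  constructor
  · rintro ⟨m, rfl⟩
    rw [← he, ← pow_mul, mul_comm (m : ℕ) M, pow_mul, hp.pow_eq_one, one_pow]
  · intro hz
    have : NeZero M := ⟨hM0⟩
    obtain ⟨i, hi, rfl⟩ := hp.eq_pow_of_pow_eq_one hz
    exact ⟨⟨i, hi⟩, (he i).symm⟩

/-- With `c = π / M`, the comparison with point `m` is a linear inequality whose boundary has
direction `m c`. The two neighbours `m = 1` and `m = M - 1` cut out the wedge; the remaining points
impose nothing new because `m c` lies in `[c, π - c]`. -/
theorem decisionRegion_psk_one (hM : 2 ≤ M) :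
    decisionRegion (pskConstellation M) 1 = (wedgeError (Real.pi / M))ᶜ := by
  have hM0 : (0 : ℝ) < M := by exact_mod_cast (by omega : 0 < M)
  have hM2 : (2 : ℝ) ≤ M := by exact_mod_cast hM
  have hpi := Real.pi_pos
  set c := Real.pi / M with hc
  have hc0 : 0 < c := by positivity
  have hMc : M * c = Real.pi := by rw [hc]; field_simp
  have hc2 : c ≤ Real.pi / 2 := by rw [hc]; gcongr
  have hsc : 0 < Real.sin c := Real.sin_pos_of_pos_of_lt_pi hc0 (by linarith)
  have hcc : 0 ≤ Real.cos c := Real.cos_nonneg_of_neg_pi_div_two_le_of_le (by linarith) hc2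
  ext z
  have hn (m : Fin M) : ‖z‖ ≤ ‖z + 1 - pskPoint M m‖ ↔
      0 ≤ Real.sin (m * c) * ((1 + z.re) * Real.sin (m * c) - z.im * Real.cos (m * c)) := by
    have h1 := Real.sin_sq_add_cos_sq (m * c)
    rw [Complex.norm_def, Complex.norm_def, Real.sqrt_le_sqrt_iff (Complex.normSq_nonneg _),
      Complex.normSq_apply, Complex.normSq_apply]
    simp only [Complex.add_re, Complex.sub_re, Complex.add_im, Complex.sub_im, pskPoint_re,
      pskPoint_im, Complex.one_re, Complex.one_im, ← hc]
    rw [Real.cos_two_mul, Real.sin_two_mul]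
    have hsq : Real.cos (m * c) ^ 2 = 1 - Real.sin (m * c) ^ 2 := by linarith
    have key : (z.re + 1 - (2 * Real.cos (m * c) ^ 2 - 1)) *
        (z.re + 1 - (2 * Real.cos (m * c) ^ 2 - 1)) +
        (z.im + 0 - 2 * Real.sin (m * c) * Real.cos (m * c)) *
        (z.im + 0 - 2 * Real.sin (m * c) * Real.cos (m * c)) - (z.re * z.re + z.im * z.im) =
        4 * (Real.sin (m * c) *
          ((1 + z.re) * Real.sin (m * c) - z.im * Real.cos (m * c))) := by
      have : (z.im + 0 - 2 * Real.sin (m * c) * Real.cos (m * c)) *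
        (z.im + 0 - 2 * Real.sin (m * c) * Real.cos (m * c)) = z.im ^ 2 -
          4 * z.im * Real.sin (m * c) * Real.cos (m * c) +
          4 * Real.sin (m * c) ^ 2 * Real.cos (m * c) ^ 2 := by ring
      rw [this, hsq]
      ring
    constructor <;> intro h <;> linarith
  have hS : pskConstellation M = Set.range (pskPoint M) := rfl
  rw [hS]
  simp only [decisionRegion, Set.forall_mem_range, Set.mem_ofPred_eq, hn, wedgeError,
    Set.mem_compl_iff, not_lt]
  constructor
  · intro h
    have h1 := h ⟨1, by omega⟩
    have h2 := h ⟨M - 1, by omega⟩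
    simp only [Nat.cast_one, one_mul] at h1
    rw [Nat.cast_sub (by omega), Nat.cast_one, sub_mul, one_mul, hMc, Real.sin_pi_sub,
      Real.cos_pi_sub] at h2
    have h3 := nonneg_of_mul_nonneg_right h1 hsc
    have h4 := nonneg_of_mul_nonneg_right h2 hsc
    rcases abs_cases z.im with ⟨ha, _⟩ | ⟨ha, _⟩ <;> rw [ha] <;> linarith
  · intro h m
    rcases Nat.eq_zero_or_pos (m : ℕ) with hm | hm
    · simp [hm]
    have hm1 : (1 : ℝ) ≤ m := by exact_mod_cast hm
    have hm2 : (m : ℝ) + 1 ≤ M := by exact_mod_cast m.2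
    have hmc : (m : ℝ) * c + c ≤ Real.pi := by rw [← hMc]; nlinarith
    have hmc0 : 0 ≤ (m : ℝ) * c - c := by nlinarith
    have hs : 0 < Real.sin (m * c) := Real.sin_pos_of_pos_of_lt_pi (by linarith) (by linarith)
    have hs1 : 0 ≤ Real.sin (m * c - c) :=
      Real.sin_nonneg_of_nonneg_of_le_pi hmc0 (by linarith)
    have hs2 : 0 ≤ Real.sin (m * c + c) :=
      Real.sin_nonneg_of_nonneg_of_le_pi (by linarith) hmc
    rw [Real.sin_sub] at hs1
    rw [Real.sin_add] at hs2
    refine mul_nonneg hs.le ?_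
    -- This is `|cot (m c)| ≤ cot c` with denominators cleared.
    have hcos : |Real.cos (m * c)| * Real.sin c ≤ Real.sin (m * c) * Real.cos c := by
      rcases abs_cases (Real.cos (m * c)) with ⟨ha, _⟩ | ⟨ha, _⟩ <;> rw [ha] <;> linarith
    have h1 : |z.im| * (|Real.cos (m * c)| * Real.sin c) ≤
        ((1 + z.re) * Real.sin (m * c)) * Real.sin c := by
      calc |z.im| * (|Real.cos (m * c)| * Real.sin c)
          ≤ |z.im| * (Real.sin (m * c) * Real.cos c) := by gcongr
        _ = (|z.im| * Real.cos c) * Real.sin (m * c) := by ring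
        _ ≤ ((1 + z.re) * Real.sin c) * Real.sin (m * c) := by gcongr
        _ = _ := by ring
    rw [← mul_assoc] at h1
    have h2 := le_of_mul_le_mul_right h1 hsc
    have h3 : z.im * Real.cos (m * c) ≤ |z.im| * |Real.cos (m * c)| := by
      rw [← abs_mul]; exact le_abs_self _
    linarith

/-- Multiplication by a root of unity permutes the constellation and preserves norms, so all points
have congruent decision regions. -/
theorem decisionRegion_psk_rotate (hM : 1 ≤ M) (u : Circle)
    (hu : (u : ℂ) ∈ pskConstellation M) :
    (fun z : ℂ => u * z) ⁻¹' decisionRegion (pskConstellation M) u =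
      decisionRegion (pskConstellation M) 1 := by
  rw [pskConstellation_eq hM] at hu ⊢
  have hu0 : (u : ℂ) ≠ 0 := Circle.coe_ne_zero u
  have hun : ‖(u : ℂ)‖ = 1 := Circle.norm_coe u
  ext z
  change (u : ℂ) ^ M = 1 at hu
  simp only [decisionRegion, Set.mem_preimage, Set.mem_ofPred_eq]
  constructor
  · intro h b hb
    have h1 := h (u * b) (by rw [mul_pow, hu, hb, one_mul])
    have e : (u : ℂ) * z + u - u * b = u * (z + 1 - b) := by ring
    rwa [e, norm_mul, norm_mul, hun, one_mul, one_mul] at h1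
  · intro h b hb
    have h1 := h (b / u) (by rw [div_pow, hu, hb, one_div_one])
    have e : (u : ℂ) * z + u - b = u * (z + 1 - b / u) := by field_simp
    rwa [e, norm_mul, norm_mul, hun, one_mul, one_mul]

theorem sum_psk_error (hM : 2 ≤ M) (hS : (pskConstellation M).Finite) {v : ℝ≥0} (hv : v ≠ 0) :
    ∑ a ∈ hS.toFinset, (cGauss v).real (decisionRegion (pskConstellation M) a)ᶜ =
      (pskConstellation M).ncard * ((1 / Real.pi) *
        ∫ θ in (0 : ℝ)..(Real.pi - Real.pi / M),
          Real.exp (-(1 / (v : ℝ) * Real.sin (Real.pi / M) ^ 2 / Real.sin θ ^ 2))) := by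
  have hM0 : (0 : ℝ) < M := by exact_mod_cast (by omega : 0 < M)
  have hM2 : (1 : ℝ) < M := by exact_mod_cast (by omega : 1 < M)
  have hpi := Real.pi_pos
  rw [← cGauss_wedgeError hv (by positivity) (div_lt_self hpi hM2), Set.ncard_eq_toFinset_card _ hS,
    ← nsmul_eq_mul, ← Finset.sum_const]
  refine Finset.sum_congr rfl fun a ha => ?_
  rw [Set.Finite.mem_toFinset] at ha
  obtain ⟨m, rfl⟩ := id ha
  have hn : pskPoint M m ∈ Submonoid.unitSphere ℂ := by
    exact mem_sphere_zero_iff_norm.2 (norm_pskPoint m)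
  let u : Circle := ⟨pskPoint M m, hn⟩
  have hrot := cGauss_rotate hv (measurableSet_decisionRegion hS (u : ℂ)).compl u
  rw [Set.preimage_compl, decisionRegion_psk_rotate (by omega) u ha, decisionRegion_psk_one hM,
    compl_compl] at hrot
  rw [measureReal_def, measureReal_def, hrot]
  rfl

end psk

/-! ### The grid error function and PAM as a grid -/

section limits

/-- The symbol error probability of a square-lattice constellation with half-spacing `c`, as a
function of the signal-to-noise ratio. -/
def gridError (M N : ℕ) (c x : ℝ) : ℝ :=
  1 - (1 - 2 * ((M : ℝ) - 1) / M * gaussQ (√(2 * c ^ 2 * x))) *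
    (1 - 2 * ((N : ℝ) - 1) / N * gaussQ (√(2 * c ^ 2 * x)))

theorem continuous_gridError (M N : ℕ) (c : ℝ) : Continuous (gridError M N c) := by
  have h : Continuous fun x : ℝ => gaussQ (√(2 * c ^ 2 * x)) :=
    continuous_gaussQ.comp (by fun_prop)
  unfold gridError
  fun_prop

/-- PAM is a grid with a single row, so the imaginary coordinate contributes no error and the grid
computation serves it as well as QAM. -/
theorem pamConstellation_eq_range (M : ℕ) :
    pamConstellation M = Set.range (gridPoint M 1 √(3 / ((M : ℝ) ^ 2 - 1))) := by
  have h (m : Fin M) (n : Fin 1) : gridPoint M 1 √(3 / ((M : ℝ) ^ 2 - 1)) (m, n) =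
      ((√(3 / ((M : ℝ) ^ 2 - 1)) * (2 * (m : ℝ) + 1 - (M : ℝ)) : ℝ) : ℂ) := by
    simp [gridPoint]
  ext z
  simp only [pamConstellation, Set.mem_range, Prod.exists, h, exists_const]

end limits

end

/-! ### The three limits -/

theorem theorem3
    (ρ : ℂ) (hρ0 : 0 < ‖ρ‖) (hρ1 : ‖ρ‖ < 1)
    (σ η : ℝ) (hσ : 0 < σ) (hη : η = 1 / σ ^ 2)
    (β : ℝ) (hβ : 1 < β)
    (nt nr : ℕ → ℕ) (hnt : Tendsto nt atTop atTop)
    (hratio : ∀ i, (nr i : ℝ) = β * (nt i : ℝ))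
    {Ω : ℕ → Type*} [∀ i, MeasurableSpace (Ω i)]
    (μ : ∀ i, Measure (Ω i)) [∀ i, IsProbabilityMeasure (μ i)]
    (S : Set ℂ)
    (H : ∀ i, Ω i → Matrix (Fin (nr i)) (Fin (nt i)) ℂ)
    (s : ∀ i, Ω i → Fin (nt i) → ℂ)
    (ξ : ∀ i, Ω i → Fin (nr i) → ℂ)
    (sHat : ∀ i, Ω i → Fin (nt i) → ℂ)
    (hlink : ∀ i, IsZFLink (μ i) S (kmsMatrix (nt i) ρ) (uniformPrecoder (nt i)) σ
      (H i) (s i) (ξ i) (sHat i)) :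
    (∀ M : ℕ, 2 ≤ M → S = pamConstellation M →
      Tendsto (fun i => averageSEP (μ i) (s i) (sHat i)) atTop
        (𝓝 (2 * ((M : ℝ) - 1) / (M : ℝ) *
          gaussQ (Real.sqrt (6 * η * (β - 1) * (1 - ‖ρ‖ ^ 2) /
            (((M : ℝ) ^ 2 - 1) * (1 + ‖ρ‖ ^ 2))))))) ∧
    (∀ M : ℕ, 2 ≤ M → S = pskConstellation M →
      Tendsto (fun i => averageSEP (μ i) (s i) (sHat i)) atTop
        (𝓝 ((1 / Real.pi) * ∫ θ in (0 : ℝ)..(((M : ℝ) - 1) * Real.pi / (M : ℝ)),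
          Real.exp (-(η * (β - 1) * (1 - ‖ρ‖ ^ 2) * Real.sin (Real.pi / (M : ℝ)) ^ 2 /
            ((1 + ‖ρ‖ ^ 2) * Real.sin θ ^ 2)))))) ∧
    (∀ M L : ℕ, 2 ≤ L → M = L ^ 2 → S = squareQAMConstellation L →
      Tendsto (fun i => averageSEP (μ i) (s i) (sHat i)) atTop
        (𝓝 (4 * (Real.sqrt (M : ℝ) - 1) / Real.sqrt (M : ℝ) *
            gaussQ (Real.sqrt (3 * η * (β - 1) * (1 - ‖ρ‖ ^ 2) /
              (((M : ℝ) - 1) * (1 + ‖ρ‖ ^ 2)))) -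
          4 * (Real.sqrt (M : ℝ) - 1) ^ 2 / (M : ℝ) *
            gaussQ (Real.sqrt (3 * η * (β - 1) * (1 - ‖ρ‖ ^ 2) /
              (((M : ℝ) - 1) * (1 + ‖ρ‖ ^ 2)))) ^ 2)))
 := by
  have hr0 : (0 : ℝ) < 1 + ‖ρ‖ ^ 2 := by positivity
  have hr1 : 0 < 1 - ‖ρ‖ ^ 2 := by nlinarith
  have hβ1 : 0 < β - 1 := by linarith
  have hσ2 : σ ^ 2 ≠ 0 := by positivity
  have hx : 0 < (β - 1) * ((1 - ‖ρ‖ ^ 2) / (1 + ‖ρ‖ ^ 2)) / σ ^ 2 := by positivity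
  -- PAM and QAM share this case, as the grids `M × 1` and `L × L`.
  have hgrid (M N : ℕ) (c : ℝ) (hc : 0 < c) (hM : 1 ≤ M) (hN : 1 ≤ N)
      (hS : S = Set.range (gridPoint M N c)) :
      Tendsto (fun i => averageSEP (μ i) (s i) (sHat i)) atTop
        (𝓝 (gridError M N c ((β - 1) * ((1 - ‖ρ‖ ^ 2) / (1 + ‖ρ‖ ^ 2)) / σ ^ 2))) := by
    have : Nonempty (Fin M × Fin N) := ⟨(⟨0, hM⟩, ⟨0, hN⟩)⟩
    have hSf : S.Finite := hS ▸ Set.finite_range _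
    refine averageSEP_tendsto hρ1 hσ hβ hnt hratio hlink hSf
      (hS ▸ Set.range_nonempty _) (fun v hv => ?_) rfl (continuous_gridError M N c).continuousAt
    subst hS
    exact sum_grid_error hM hN hc hSf hv
  refine ⟨fun M hM hS => ?_, fun M hM hS => ?_, fun M L hL hML hS => ?_⟩
  · have hM1 : (2 : ℝ) ≤ M := by exact_mod_cast hM
    have hM2 : (0 : ℝ) < (M : ℝ) ^ 2 - 1 := by nlinarith
    have hc : 0 < √(3 / ((M : ℝ) ^ 2 - 1)) := Real.sqrt_pos.2 (by positivity)
    convert hgrid M 1 _ hc (by omega) le_rfl (hS.trans (pamConstellation_eq_range M)) using 2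
    -- For `N = 1` the second factor of `gridError` equals `1`, which leaves one tail term.
    rw [gridError, Real.sq_sqrt (by positivity)]
    have e : 6 * η * (β - 1) * (1 - ‖ρ‖ ^ 2) / (((M : ℝ) ^ 2 - 1) * (1 + ‖ρ‖ ^ 2)) =
        2 * (3 / ((M : ℝ) ^ 2 - 1)) * ((β - 1) * ((1 - ‖ρ‖ ^ 2) / (1 + ‖ρ‖ ^ 2)) / σ ^ 2) := by
      rw [hη]; field_simp; ring
    rw [e, Nat.cast_one]
    ring
  · have hM0 : (0 : ℝ) < M := by exact_mod_cast (by omega : 0 < M)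
    have : Nonempty (Fin M) := ⟨⟨0, by omega⟩⟩
    have hSf : S.Finite := hS ▸ Set.finite_range _
    convert averageSEP_tendsto hρ1 hσ hβ hnt hratio hlink hSf (hS ▸ Set.range_nonempty _)
      (f := fun x => (1 / Real.pi) * ∫ θ in (0 : ℝ)..(Real.pi - Real.pi / M),
        Real.exp (-(x * Real.sin (Real.pi / M) ^ 2 / Real.sin θ ^ 2)))
      (fun v hv => ?_) rfl (continuousAt_craig _ _ _ hx) using 2
    · have e : ((M : ℝ) - 1) * Real.pi / M = Real.pi - Real.pi / M := by field_simp
      rw [e]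
      congr 2
      funext θ
      congr 2
      rw [hη]
      simp only [div_eq_mul_inv, mul_inv]
      ring
    · subst hS
      exact sum_psk_error hM hSf hv
  · have hL1 : (2 : ℝ) ≤ L := by exact_mod_cast hL
    have hL2 : (0 : ℝ) < (L : ℝ) ^ 2 - 1 := by nlinarith
    have hc : 0 < √(3 / (2 * ((L : ℝ) ^ 2 - 1))) := Real.sqrt_pos.2 (by positivity)
    convert hgrid L L _ hc (by omega) (by omega) hS using 2
    -- Here both factors coincide, and expanding `1 - (1 - 2 (L-1)/L · Q)²` gives the two terms of
    -- the formula with `√M = L`.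
    rw [gridError, Real.sq_sqrt (by positivity)]
    have e : 3 * η * (β - 1) * (1 - ‖ρ‖ ^ 2) / (((M : ℝ) - 1) * (1 + ‖ρ‖ ^ 2)) =
        2 * (3 / (2 * ((L : ℝ) ^ 2 - 1))) *
          ((β - 1) * ((1 - ‖ρ‖ ^ 2) / (1 + ‖ρ‖ ^ 2)) / σ ^ 2) := by
      rw [hη, hML, Nat.cast_pow]; field_simp
    rw [e, hML, Nat.cast_pow, Real.sqrt_sq (by positivity)]
    field_simp
    ring
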